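/- Let $0<H<1$ and $\theta>0$. Let $S^H=\{S^H_t\}_{t\ge 0}$ be a sub-fractional Brownian motion with parameter $H$, i.e. a mean-zero Gaussian process with almost surely continuous paths and covariance $$E\left(S^H_tS^H_s\right)=t^{2H}+s^{2H}-\tfrac12\left((t+s)^{2H}+|t-s|^{2H}\right),\qquad s,t\ge 0.$$ Let $X=\{X_t\}_{t\ge 0}$ be the sub-fractional Ornstein–Uhlenbeck process, i.e. the solution with continuous paths of $$dX_t=-\theta X_t\,dt+dS^H_t,\qquad X_0=0,$$ which means that, almost surely, $X_t=-\theta\int_0^tX_s\,ds+S^H_t$ for all $t\ge 0$. For $n\ge 1$ put $$\hat f_n(X)=\frac1n\sum_{i=1}^nX_i^2 .$$ Then, almost surely as $n\to\infty$, $$\hat f_n(X)\longrightarrow f_H(\theta):=\frac{H\,\Gamma(2H)}{\theta^{2H}} .$$ -/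

import Mathlib

open MeasureTheory ProbabilityTheory Filter
open scoped NNReal Topology

noncomputable section

/-- The covariance function of sub-fractional Brownian motion with parameter `H`:
`R(s,t) = t^{2H} + s^{2H} - (1/2) ((t+s)^{2H} + |t-s|^{2H})` for `s, t ≥ 0`. -/
def sfBmCov (H : ℝ) (s t : ℝ≥0) : ℝ :=
  (t : ℝ) ^ (2 * H) + (s : ℝ) ^ (2 * H)
    - 1 / 2 * (((t : ℝ) + s) ^ (2 * H) + |(t : ℝ) - s| ^ (2 * H))

/-- `S = (S_t)_{t ≥ 0}` is a sub-fractional Brownian motion with parameter `H` under `P`: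
a mean-zero Gaussian process with covariance `sfBmCov H` and almost surely continuous paths. -/
structure IsSubFractionalBM {Ω : Type*} [MeasurableSpace Ω] (P : Measure Ω)
    (H : ℝ) (S : ℝ≥0 → Ω → ℝ) : Prop where
  gaussian : IsGaussianProcess S P
  mean_zero : ∀ t, ∫ ω, S t ω ∂P = 0
  covariance : ∀ s t, ∫ ω, S t ω * S s ω ∂P = sfBmCov H s t
  continuous_paths : ∀ᵐ ω ∂P, Continuous fun t => S t ω

/-- `X` solves `dX_t = -θ X_t dt + dG_t`, `X_0 = 0`, driven by the process `G`:
almost surely, `X` has continuous paths and `X_0 = 0`,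
`X_t = -θ ∫_0^t X_s ds + (G_t - G_0)` for all `t ≥ 0`. -/
def IsOUSolution {Ω : Type*} [MeasurableSpace Ω] (P : Measure Ω)
    (θ : ℝ) (G X : ℝ≥0 → Ω → ℝ) : Prop :=
  ∀ᵐ ω ∂P, (Continuous fun t => X t ω) ∧ X 0 ω = 0 ∧
    ∀ t : ℝ≥0, X t ω = -θ * (∫ s in (0 : ℝ)..t, X s.toNNReal ω) + (G t ω - G 0 ω)

/-- The estimator `(1/n) ∑_{i=1}^n X_i²` based on the observations `X_1, …, X_n`. -/
def quadEstimator {Ω : Type*} (X : ℝ≥0 → Ω → ℝ) (n : ℕ) (ω : Ω) : ℝ :=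
  1 / (n : ℝ) * ∑ i ∈ Finset.Icc 1 n, X (i : ℝ≥0) ω ^ 2

/-- `f_H(θ) = H Γ(2H) / θ^{2H}`. -/
def asympVariance (H θ : ℝ) : ℝ := H * Real.Gamma (2 * H) / θ ^ (2 * H)

end

/-! Variation of constants gives X_t = ∫ (S_t - S_{t-w}) dν(w), where ν is the exponential law of
rate θ and times are truncated at 0 (`eq_integral_nnrealExpMeasure`). So X is an average of
increments of S. The covariance of two increments consists of two second differences of |x|^{2H},
one near t - s and one near t + s. It is therefore O((1+|t-s|)^{2H-2}), with a factor polynomial in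
the increment lengths (`abs_sfBmIncrCov_le`) that has finite moments under ν. By Isserlis' formula
the variance of ∑ X_i² is twice the sum of the squared covariances, hence O(n^{2-β}) for some β > 0,
and a strong law along geometric subsequences follows (`ae_tendsto_average_of_lintegral_sq_le`).
Gaussianity of X itself is never needed: ν is discretised, and Fatou's lemma transfers the bound
(`lintegral_sq_sum_sq_sub_le`). As n → ∞ the term near t + s vanishes and E X_n² tends to the
ν⊗ν-average of the fractional Brownian covariance, which memorylessness of ν evaluates
(`integral_prod_nnrealExpMeasure`). -/

/-! ### Second differences of power functions. -/

lemma abs_rpow_sub_rpow_le {q m x y : ℝ} (hq : q ≤ 1) (hm : 0 < m) (hx : m ≤ x) (hy : m ≤ y) :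
    |y ^ q - x ^ q| ≤ |q| * m ^ (q - 1) * |y - x| := by
  have key := (convex_Ici m).norm_image_sub_le_of_norm_hasDerivWithin_le
    (f := fun x : ℝ => x ^ q) (f' := fun x => q * x ^ (q - 1)) (C := |q| * m ^ (q - 1))
    (fun z hz => (Real.hasDerivAt_rpow_const
      (Or.inl (hm.trans_le hz).ne')).hasDerivWithinAt) (fun z hz => ?_) hx hy
  · simpa using key
  · have hz0 : 0 < z := hm.trans_le hz
    rw [Real.norm_eq_abs, abs_mul, abs_of_nonneg (Real.rpow_nonneg hz0.le _)]
    exact mul_le_mul_of_nonneg_left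
      (Real.rpow_le_rpow_of_nonpos hm hz (sub_nonpos.2 hq)) (abs_nonneg _)

/-- Mean value inequality twice: in the shift a for x ^ p - (x - b) ^ p, then in b for its
derivative. The hypothesis on k keeps every argument at least k / 2, which in turn is at least (1 +
k) / 4. -/
lemma abs_second_difference_le_of_far {p k a b : ℝ} (hp0 : 0 < p) (hp2 : p < 2) (ha : 0 ≤ a)
    (hb : 0 ≤ b) (hk : 1 + 2 * b ≤ k) :
    |((k + a) ^ p - (k + a - b) ^ p) - (k ^ p - (k - b) ^ p)|
      ≤ 32 * a * b * (1 + k) ^ (p - 2) := by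
  have hk2 : (0 : ℝ) < k / 2 := by linarith
  have key := (convex_Ici k).norm_image_sub_le_of_norm_hasDerivWithin_le
    (f := fun x : ℝ => x ^ p - (x - b) ^ p)
    (f' := fun x => p * x ^ (p - 1) - p * (x - b) ^ (p - 1))
    (C := 2 * ((k / 2) ^ (p - 2) * b)) (x := k) (y := k + a)
    (fun z hz => ?_) (fun z hz => ?_) (by simp) (by simpa using ha)
  · have h4 : (k / 2) ^ (p - 2) ≤ 16 * (1 + k) ^ (p - 2) := by
      calc (k / 2) ^ (p - 2) ≤ ((1 + k) / 4) ^ (p - 2) :=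
            Real.rpow_le_rpow_of_nonpos (by linarith) (by linarith) (by linarith)
        _ = (1 + k) ^ (p - 2) * 4 ^ (2 - p) := by
            rw [Real.div_rpow (by linarith) (by norm_num), div_eq_mul_inv,
              ← Real.rpow_neg (by norm_num), neg_sub]
        _ ≤ (1 + k) ^ (p - 2) * 4 ^ (2 : ℝ) := by
            have : 0 ≤ (1 + k) ^ (p - 2) := Real.rpow_nonneg (by linarith) _
            have : 2 - p ≤ 2 := by linarith
            gcongr
            norm_num
        _ = 16 * (1 + k) ^ (p - 2) := by norm_num; ring
    simp only [Real.norm_eq_abs, add_sub_cancel_left, abs_of_nonneg ha] at key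
    refine key.trans ?_
    calc 2 * ((k / 2) ^ (p - 2) * b) * a ≤ 2 * (16 * (1 + k) ^ (p - 2) * b) * a := by gcongr
      _ = _ := by ring
  · have hz' : k ≤ z := hz
    have h1 : HasDerivAt (fun x : ℝ => x ^ p) (p * z ^ (p - 1)) z :=
      Real.hasDerivAt_rpow_const (Or.inl (by linarith))
    have h2 : HasDerivAt (fun x : ℝ => x ^ p) (p * (z - b) ^ (p - 1)) (z - b) :=
      Real.hasDerivAt_rpow_const (Or.inl (by linarith))
    exact (h1.sub (h2.comp_sub_const z b)).hasDerivWithinAt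
  · have hz' : k ≤ z := hz
    have := abs_rpow_sub_rpow_le (q := p - 1) (m := k / 2) (x := z - b) (y := z)
      (by linarith) hk2 (by linarith) (by linarith)
    rw [show p - 1 - 1 = p - 2 by ring, show z - (z - b) = b by ring, abs_of_nonneg hb] at this
    rw [Real.norm_eq_abs, ← mul_sub, abs_mul, abs_of_pos hp0]
    have hq : |p - 1| ≤ 1 := abs_le.2 ⟨by linarith, by linarith⟩
    have hpos : 0 ≤ (k / 2) ^ (p - 2) * b := by positivity
    calc p * |z ^ (p - 1) - (z - b) ^ (p - 1)| ≤ 2 * (|p - 1| * (k / 2) ^ (p - 2) * b) := by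
          gcongr
      _ ≤ 2 * (1 * ((k / 2) ^ (p - 2) * b)) := by rw [mul_assoc |p - 1|]; gcongr
      _ = _ := by ring

lemma abs_second_difference_le {p k a b : ℝ} (hp0 : 0 < p) (hp2 : p < 2) (hk : 0 ≤ k)
    (ha : 0 ≤ a) (hb : 0 ≤ b) :
    |(|k + a| ^ p - |k + a - b| ^ p) - (|k| ^ p - |k - b| ^ p)|
      ≤ 32 * (1 + a) ^ 2 * (1 + b) ^ 4 * (1 + k) ^ (p - 2) := by
  have hpos : 0 ≤ (1 + k) ^ (p - 2) := by positivity
  rcases le_total (1 + 2 * b) k with h | h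
  · rw [abs_of_nonneg (by linarith : 0 ≤ k + a), abs_of_nonneg (by linarith : 0 ≤ k + a - b),
      abs_of_nonneg hk, abs_of_nonneg (by linarith : 0 ≤ k - b)]
    refine (abs_second_difference_le_of_far hp0 hp2 ha hb h).trans ?_
    have h1 : a ≤ (1 + a) ^ 2 := by nlinarith
    have h2 : b ≤ (1 + b) ^ 4 := by nlinarith [one_le_pow₀ (n := 3) (by linarith : 1 ≤ 1 + b)]
    gcongr
  -- Near the singularity smoothness is not used: all four arguments are at most M in absolute
  -- value, and since k ≤ 1 + 2b the decay factor costs at most 4(1+b)². The constant is 2·4·4 = 32.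
  · set M := 2 * ((1 + a) * (1 + b)) with hM
    have hab : 0 ≤ a * b := by positivity
    have hM1 : 1 ≤ M := by nlinarith
    have hg : ∀ x : ℝ, |x| ≤ M → |x| ^ p ≤ M ^ 2 := fun x hx => by
      calc |x| ^ p ≤ M ^ p := by gcongr
        _ ≤ M ^ (2 : ℝ) := Real.rpow_le_rpow_of_exponent_le hM1 hp2.le
        _ = M ^ 2 := by norm_cast
    have g0 : ∀ x : ℝ, 0 ≤ |x| ^ p := fun x => by positivity
    have h1 := hg (k + a) (abs_le.2 ⟨by nlinarith, by nlinarith⟩)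
    have h2 := hg (k + a - b) (abs_le.2 ⟨by nlinarith, by nlinarith⟩)
    have h3 := hg k (abs_le.2 ⟨by nlinarith, by nlinarith⟩)
    have h4 := hg (k - b) (abs_le.2 ⟨by nlinarith, by nlinarith⟩)
    have hk' : 1 ≤ 4 * (1 + b) ^ 2 * (1 + k) ^ (p - 2) := by
      have : (1 + k) ^ (2 - p) ≤ 4 * (1 + b) ^ 2 := by
        calc (1 + k) ^ (2 - p) ≤ (2 * (1 + b)) ^ (2 - p) := by gcongr; linarith
          _ ≤ (2 * (1 + b)) ^ (2 : ℝ) :=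
            Real.rpow_le_rpow_of_exponent_le (by linarith) (by linarith)
          _ = 4 * (1 + b) ^ 2 := by norm_cast; ring
      calc 1 = (1 + k) ^ (2 - p) * (1 + k) ^ (p - 2) := by
            rw [← Real.rpow_add (by linarith)]; simp
        _ ≤ _ := by gcongr
    calc |(|k + a| ^ p - |k + a - b| ^ p) - (|k| ^ p - |k - b| ^ p)| ≤ 2 * M ^ 2 :=
          abs_le.2 ⟨by linarith [g0 (k + a), g0 (k + a - b), g0 k, g0 (k - b)],
            by linarith [g0 (k + a), g0 (k + a - b), g0 k, g0 (k - b)]⟩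
      _ ≤ 2 * M ^ 2 * (4 * (1 + b) ^ 2 * (1 + k) ^ (p - 2)) :=
          le_mul_of_one_le_right (by positivity) hk'
      _ = _ := by rw [hM]; ring

/-! ### Covariance of increments. -/

/-- The covariance of the increments `S_s - S_{s-a}` and `S_t - S_{t-b}` of a sub-fractional
Brownian motion `S`, where the differences of times are truncated at `0`. -/
noncomputable def sfBmIncrCov (H : ℝ) (s t a b : ℝ≥0) : ℝ :=
  sfBmCov H s t - sfBmCov H (s - a) t - sfBmCov H s (t - b) + sfBmCov H (s - a) (t - b)

lemma sfBmCov_comm (H : ℝ) (s t : ℝ≥0) : sfBmCov H s t = sfBmCov H t s := by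
  simp only [sfBmCov, add_comm (t : ℝ) s, abs_sub_comm (t : ℝ) s]; ring

lemma sfBmIncrCov_comm (H : ℝ) (s t a b : ℝ≥0) :
    sfBmIncrCov H s t a b = sfBmIncrCov H t s b a := by
  simp only [sfBmIncrCov, sfBmCov_comm H t, sfBmCov_comm H (t - b)]; ring

/-- The one-time terms cancel. What remains is the fractional Brownian part around t - s, minus a
reflected part coming from (t+s)^{2H}. Here a' and b' are the true increment lengths after
truncation at 0. -/
lemma sfBmIncrCov_eq (H : ℝ) (s t a b : ℝ≥0) {a' b' : ℝ} (ha : ((s - a : ℝ≥0) : ℝ) = s - a')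
    (hb : ((t - b : ℝ≥0) : ℝ) = t - b') (ha0 : a' ≤ s) (hb0 : b' ≤ t) :
    sfBmIncrCov H s t a b =
      1 / 2 * ((|(t - s : ℝ) + a'| ^ (2 * H) - |(t - s : ℝ) + a' - b'| ^ (2 * H)) -
        (|(t - s : ℝ)| ^ (2 * H) - |(t - s : ℝ) - b'| ^ (2 * H))) -
      1 / 2 * ((|(t + s - a' : ℝ) + a'| ^ (2 * H) - |(t + s - a' : ℝ) + a' - b'| ^ (2 * H)) -
        (|(t + s - a' : ℝ)| ^ (2 * H) - |(t + s - a' : ℝ) - b'| ^ (2 * H))) := by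
  have hs : (0 : ℝ) ≤ s := s.2
  have ht : (0 : ℝ) ≤ t := t.2
  simp only [sfBmIncrCov, sfBmCov, ha, hb]
  rw [abs_of_nonneg (by linarith : (0 : ℝ) ≤ t + s - a' + a'),
    abs_of_nonneg (by linarith : (0 : ℝ) ≤ t + s - a' + a' - b'),
    abs_of_nonneg (by linarith : (0 : ℝ) ≤ t + s - a'),
    abs_of_nonneg (by linarith [ha0, hb0] : (0 : ℝ) ≤ t + s - a' - b')]
  ring_nf

lemma abs_sfBmIncrCov_le_of_le {H : ℝ} (hH0 : 0 < H) (hH1 : H < 1) {s t : ℝ≥0} (hst : s ≤ t)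
    (a b : ℝ≥0) :
    |sfBmIncrCov H s t a b| ≤
      32 * (1 + a : ℝ) ^ 4 * (1 + b : ℝ) ^ 4 * (1 + |(t : ℝ) - s|) ^ (2 * H - 2) := by
  obtain ⟨a', ha, ha0, haa, has⟩ : ∃ a' : ℝ, ((s - a : ℝ≥0) : ℝ) = s - a' ∧ 0 ≤ a' ∧ a' ≤ a ∧
      a' ≤ s := by
    refine ⟨s - ((s - a : ℝ≥0) : ℝ), by ring, ?_, ?_, ?_⟩
    · simp
    · rw [NNReal.coe_sub_def]; linarith [le_max_left ((s : ℝ) - a) 0]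
    · simp
  obtain ⟨b', hb, hb0, hbb, hbt⟩ : ∃ b' : ℝ, ((t - b : ℝ≥0) : ℝ) = t - b' ∧ 0 ≤ b' ∧ b' ≤ b ∧
      b' ≤ t := by
    refine ⟨t - ((t - b : ℝ≥0) : ℝ), by ring, ?_, ?_, ?_⟩
    · simp
    · rw [NNReal.coe_sub_def]; linarith [le_max_left ((t : ℝ) - b) 0]
    · simp
  have hs : (0 : ℝ) ≤ s := s.2
  have hst' : (s : ℝ) ≤ t := hst
  have hp2 : 2 * H < 2 := by linarith
  rw [sfBmIncrCov_eq H s t a b ha hb has hbt]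
  have h1 := abs_second_difference_le (p := 2 * H) (k := t - s) (by linarith) hp2
    (by linarith) ha0 hb0
  have h2 := abs_second_difference_le (p := 2 * H) (k := t + s - a') (by linarith) hp2
    (by linarith) ha0 hb0
  -- Since a' ≤ s, the reflected base point is at least t, hence at least t - s, so its decay is no
  -- slower.
  have h3 : (1 + (t + s - a')) ^ (2 * H - 2) ≤ (1 + ((t : ℝ) - s)) ^ (2 * H - 2) :=
    Real.rpow_le_rpow_of_nonpos (by linarith) (by linarith) (by linarith)
  set K := (1 + ((t : ℝ) - s)) ^ (2 * H - 2)
  have hK : 0 ≤ K := Real.rpow_nonneg (by linarith) _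
  -- The power of 1 + a is raised to 4 to make the bound symmetric, so that the case t ≤ s follows
  -- by exchanging the roles.
  have hC : 32 * (1 + a') ^ 2 * (1 + b') ^ 4 ≤ 32 * (1 + a : ℝ) ^ 4 * (1 + b : ℝ) ^ 4 := by
    have : (1 + a' : ℝ) ^ 2 ≤ (1 + a) ^ 4 :=
      (pow_le_pow_left₀ (by linarith) (by linarith) 2).trans
        (pow_le_pow_right₀ (by simp) (by norm_num))
    gcongr
  rw [show (1 + |(t : ℝ) - s|) ^ (2 * H - 2) = K by rw [abs_of_nonneg (sub_nonneg.2 hst')]]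
  have h1' := h1.trans (mul_le_mul_of_nonneg_right hC hK)
  have h2' := h2.trans (mul_le_mul hC h3 (Real.rpow_nonneg (by linarith) _) (by positivity))
  rw [abs_le] at h1' h2' ⊢
  constructor <;> linarith [h1'.1, h1'.2, h2'.1, h2'.2]

lemma abs_sfBmIncrCov_le {H : ℝ} (hH0 : 0 < H) (hH1 : H < 1) (s t a b : ℝ≥0) :
    |sfBmIncrCov H s t a b| ≤
      32 * (1 + a : ℝ) ^ 4 * (1 + b : ℝ) ^ 4 * (1 + |(t : ℝ) - s|) ^ (2 * H - 2) := by
  rcases le_total s t with h | h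
  · exact abs_sfBmIncrCov_le_of_le hH0 hH1 h a b
  · rw [sfBmIncrCov_comm, abs_sub_comm]
    refine (abs_sfBmIncrCov_le_of_le hH0 hH1 h b a).trans_eq (by ring)

/-- Once n exceeds a and b there is no truncation: the fractional Brownian part is constant in n,
and the reflected part is a second difference at 2n - a, which decays. -/
lemma tendsto_sfBmIncrCov_self {H : ℝ} (hH0 : 0 < H) (hH1 : H < 1) (a b : ℝ≥0) :
    Tendsto (fun n : ℕ => sfBmIncrCov H n n a b) atTop
      (𝓝 (1 / 2 * ((a : ℝ) ^ (2 * H) + (b : ℝ) ^ (2 * H) - |(a : ℝ) - b| ^ (2 * H)))) := by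
  have hlim : Tendsto (fun n : ℕ => (|(n + n - a : ℝ) + a| ^ (2 * H) -
      |(n + n - a : ℝ) + a - b| ^ (2 * H)) -
        (|(n + n - a : ℝ)| ^ (2 * H) - |(n + n - a : ℝ) - b| ^ (2 * H))) atTop (𝓝 0) := by
    refine squeeze_zero_norm' (a := fun n : ℕ => 32 * (1 + a : ℝ) ^ 2 * (1 + b : ℝ) ^ 4 *
      (1 + (n + n - a : ℝ)) ^ (2 * H - 2)) ?_ ?_
    · filter_upwards [eventually_ge_atTop ⌈a⌉₊] with n hn
      have : (a : ℝ) ≤ n := by exact_mod_cast Nat.ceil_le.1 hn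
      exact abs_second_difference_le (by linarith) (by linarith) (by linarith) a.2 b.2
    · have h0 : Tendsto (fun x : ℝ => x ^ (2 * H - 2)) atTop (𝓝 0) := by
        have := tendsto_rpow_neg_atTop (y := 2 - 2 * H) (by linarith)
        simpa using this
      have h1 : Tendsto (fun n : ℕ => 1 + (n + n - a : ℝ)) atTop atTop := by
        refine tendsto_atTop_mono (f := fun n : ℕ => (n : ℝ) + (1 - a)) (fun n => ?_)
          (tendsto_atTop_add_const_right _ _ tendsto_natCast_atTop_atTop)
        linarith [(Nat.cast_nonneg n : (0 : ℝ) ≤ n)]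
      simpa using (h0.comp h1).const_mul (32 * (1 + a : ℝ) ^ 2 * (1 + b : ℝ) ^ 4)
  have := (tendsto_const_nhds (x := 1 / 2 * ((a : ℝ) ^ (2 * H) + (b : ℝ) ^ (2 * H) -
    |(a : ℝ) - b| ^ (2 * H)))).sub (hlim.const_mul (1 / 2))
  rw [mul_zero, sub_zero] at this
  refine this.congr' ?_
  filter_upwards [eventually_ge_atTop (⌈a⌉₊ + ⌈b⌉₊)] with n hn
  have ha : a ≤ n := Nat.ceil_le.1 (by omega)
  have hb : b ≤ n := Nat.ceil_le.1 (by omega)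
  rw [sfBmIncrCov_eq H n n a b (a' := a) (b' := b) (by rw [NNReal.coe_sub ha])
    (by rw [NNReal.coe_sub hb]) (by exact_mod_cast ha) (by exact_mod_cast hb)]
  simp only [NNReal.coe_natCast]
  congr 2
  have hH : 2 * H ≠ 0 := by positivity
  simp [Real.zero_rpow hH]
  ring

/-! ### Gaussian fourth moments and Isserlis' formula. -/

lemma integral_pow_four_gaussianReal (v : ℝ≥0) :
    ∫ x, x ^ 4 ∂(gaussianReal 0 v) = 3 * (v : ℝ) ^ 2 := by
  have h := iteratedDeriv_mgf_zero (X := fun x : ℝ => x) (μ := gaussianReal 0 v)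
    (by rw [integrableExpSet_fun_id_gaussianReal]; simp) 4
  simp only [Pi.pow_apply] at h
  rw [← h, mgf_fun_id_gaussianReal]
  have hE : ∀ t : ℝ, HasDerivAt (fun t : ℝ => Real.exp (0 * t + v * t ^ 2 / 2))
      (v * t * Real.exp (0 * t + v * t ^ 2 / 2)) t := fun t => by
    have : HasDerivAt (fun t : ℝ => 0 * t + v * t ^ 2 / 2) (v * t) t := by
      have h2 := (((hasDerivAt_id t).const_mul 0).add
        ((((hasDerivAt_id t).pow 2).const_mul (v : ℝ)).div_const 2))
      convert! h2 using 1
      simp; ring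
    convert! this.exp using 1
    ring
  set E : ℝ → ℝ := fun t => Real.exp (0 * t + v * t ^ 2 / 2) with hEdef
  -- Each derivative of the moment generating function E is a polynomial times E; this rule updates
  -- the polynomial, and the fourth one at 0 is the moment.
  have hmul : ∀ (f : ℝ → ℝ) (f' t : ℝ), HasDerivAt f f' t →
      deriv (fun t => f t * E t) t = (f' + f t * (v * t)) * E t := fun f f' t hf => by
    have := (hf.mul (hE t)).deriv
    rw [show (fun t => f t * E t) = f * E from rfl, this]; ring
  have d1 : deriv E = fun t => (v * t) * E t := funext fun t => (hE t).deriv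
  have d2 : deriv (fun t => (v * t) * E t) = fun t : ℝ => (v + v ^ 2 * t ^ 2) * E t := by
    funext t
    rw [hmul (fun t => v * t) v t (by simpa using (hasDerivAt_id t).const_mul (v : ℝ))]
    ring
  have d3 : deriv (fun t : ℝ => (v + v ^ 2 * t ^ 2) * E t) =
      fun t : ℝ => (3 * v ^ 2 * t + v ^ 3 * t ^ 3) * E t := by
    funext t
    rw [hmul (fun t => v + v ^ 2 * t ^ 2) (v ^ 2 * (2 * t)) t
      (by simpa using ((hasDerivAt_pow 2 t).const_mul ((v : ℝ) ^ 2)).const_add (v : ℝ))]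
    ring
  have d4 : deriv (fun t : ℝ => (3 * v ^ 2 * t + v ^ 3 * t ^ 3) * E t) 0 = 3 * (v : ℝ) ^ 2 := by
    rw [hmul (fun t => 3 * (v : ℝ) ^ 2 * t + (v : ℝ) ^ 3 * t ^ 3)
      (3 * (v : ℝ) ^ 2 + (v : ℝ) ^ 3 * (3 * (0 : ℝ) ^ 2)) 0
      ((((hasDerivAt_id (0 : ℝ)).const_mul (3 * (v : ℝ) ^ 2)).add
        ((hasDerivAt_pow 3 (0 : ℝ)).const_mul ((v : ℝ) ^ 3))).congr_deriv (by simp))]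
    simp [hEdef]
  simp only [iteratedDeriv_succ, iteratedDeriv_zero]
  rw [d1, d2, d3, d4]

section Gaussian

variable {Ω : Type*} {mΩ : MeasurableSpace Ω} {P : Measure Ω} {X Y : Ω → ℝ}

lemma ProbabilityTheory.HasGaussianLaw.integral_pow_four (hX : HasGaussianLaw X P)
    (h0 : ∫ ω, X ω ∂P = 0) :
    ∫ ω, X ω ^ 4 ∂P = 3 * (∫ ω, X ω ^ 2 ∂P) ^ 2 := by
  have hm := hX.aemeasurable
  have hlaw := hX.map_eq_gaussianReal
  rw [h0] at hlaw
  have h4 : ∫ ω, X ω ^ 4 ∂P = ∫ x, x ^ 4 ∂(P.map X) :=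
    (integral_map hm (f := fun x => x ^ 4) (by fun_prop)).symm
  rw [h4, hlaw, integral_pow_four_gaussianReal, Real.coe_toNNReal _ (variance_nonneg _ _),
    variance_of_integral_eq_zero hm h0]

/-- Isserlis' formula for the second mixed moments of squares. -/
lemma ProbabilityTheory.HasGaussianLaw.integral_sq_mul_sq
    (hXY : HasGaussianLaw (fun ω => (X ω, Y ω)) P)
    (hX0 : ∫ ω, X ω ∂P = 0) (hY0 : ∫ ω, Y ω ∂P = 0) :
    ∫ ω, X ω ^ 2 * Y ω ^ 2 ∂P =
      (∫ ω, X ω ^ 2 ∂P) * (∫ ω, Y ω ^ 2 ∂P) + 2 * (∫ ω, X ω * Y ω ∂P) ^ 2 := by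
  have hX := hXY.fst
  have hY := hXY.snd
  have hA := hXY.fun_add
  have hS := hXY.fun_sub
  have i2 : ∀ {Z : Ω → ℝ}, HasGaussianLaw Z P → Integrable (fun ω => Z ω ^ 2) P :=
    fun hZ => hZ.memLp_two.integrable_sq
  have i4 : ∀ {Z : Ω → ℝ}, HasGaussianLaw Z P → Integrable (fun ω => Z ω ^ 4) P := fun {Z} hZ => by
    have := (hZ.memLp (p := 4) (by norm_num)).integrable_norm_pow (p := 4) (by norm_num)
    refine this.congr (ae_of_all _ fun ω => ?_)
    simp only [Real.norm_eq_abs]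
    exact Even.pow_abs (by decide) _
  have hXYi : Integrable (fun ω => X ω * Y ω) P := hX.memLp_two.integrable_mul hY.memLp_two
  have e1 := hX.integral_pow_four hX0
  have e2 := hY.integral_pow_four hY0
  have e3 := hA.integral_pow_four (by rw [integral_add hX.integrable hY.integrable, hX0, hY0]; simp)
  have e4 := hS.integral_pow_four (by rw [integral_sub hX.integrable hY.integrable, hX0, hY0]; simp)
  have i2XY : Integrable (fun ω => X ω ^ 2 + Y ω ^ 2) P := (i2 hX).add (i2 hY)
  have i4AS : Integrable (fun ω => (X ω + Y ω) ^ 4 + (X ω - Y ω) ^ 4) P := (i4 hA).add (i4 hS)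
  have i4ASX : Integrable (fun ω => (X ω + Y ω) ^ 4 + (X ω - Y ω) ^ 4 - 2 * X ω ^ 4) P :=
    i4AS.sub ((i4 hX).const_mul 2)
  have q3 : ∫ ω, (X ω + Y ω) ^ 2 ∂P =
      (∫ ω, X ω ^ 2 ∂P) + (∫ ω, Y ω ^ 2 ∂P) + 2 * ∫ ω, X ω * Y ω ∂P := by
    rw [← integral_add (i2 hX) (i2 hY), ← integral_const_mul,
      ← integral_add i2XY (hXYi.const_mul 2)]
    exact integral_congr_ae (ae_of_all _ fun ω => by ring)
  have q4 : ∫ ω, (X ω - Y ω) ^ 2 ∂P =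
      (∫ ω, X ω ^ 2 ∂P) + (∫ ω, Y ω ^ 2 ∂P) - 2 * ∫ ω, X ω * Y ω ∂P := by
    rw [← integral_add (i2 hX) (i2 hY), ← integral_const_mul,
      ← integral_sub i2XY (hXYi.const_mul 2)]
    exact integral_congr_ae (ae_of_all _ fun ω => by ring)
  -- Polarisation, 12x²y² = (x+y)⁴ + (x-y)⁴ - 2x⁴ - 2y⁴, reduces the mixed moment to fourth moments
  -- of one-dimensional Gaussians.
  have q : 12 * ∫ ω, X ω ^ 2 * Y ω ^ 2 ∂P = (∫ ω, (X ω + Y ω) ^ 4 ∂P) +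
      (∫ ω, (X ω - Y ω) ^ 4 ∂P) - 2 * (∫ ω, X ω ^ 4 ∂P) - 2 * (∫ ω, Y ω ^ 4 ∂P) := by
    rw [← integral_const_mul, ← integral_const_mul, ← integral_const_mul,
      ← integral_add (i4 hA) (i4 hS), ← integral_sub i4AS ((i4 hX).const_mul 2),
      ← integral_sub i4ASX ((i4 hY).const_mul 2)]
    exact integral_congr_ae (ae_of_all _ fun ω => by ring)
  rw [e1, e2, e3, e4, q3, q4] at q
  linarith

lemma ProbabilityTheory.HasGaussianLaw.integrable_sq_mul_sq
    (hX : HasGaussianLaw X P) (hY : HasGaussianLaw Y P) :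
    Integrable (fun ω => X ω ^ 2 * Y ω ^ 2) P := by
  have h4 : ∀ {Z : Ω → ℝ}, HasGaussianLaw Z P → MemLp (fun ω => Z ω ^ 2) 2 P := fun {Z} hZ => by
    have := (hZ.memLp (p := 4) (by norm_num)).norm_rpow_div 2
    have h42 : (4 : ENNReal) / 2 = 2 := by
      rw [ENNReal.div_eq_inv_mul, show (4 : ENNReal) = 2 * 2 by norm_num, ← mul_assoc,
        ENNReal.inv_mul_cancel (by norm_num) (by norm_num), one_mul]
    rw [h42] at this
    refine this.ae_eq (ae_of_all _ fun ω => ?_)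
    simp
  exact (h4 hX).integrable_mul (h4 hY)

/-- The variance of the sum of squares of a centred Gaussian family. -/
lemma ProbabilityTheory.IsGaussianProcess.integral_sq_sum_sq_sub {ι : Type*} {Z : ι → Ω → ℝ}
    (hZ : IsGaussianProcess Z P) (h0 : ∀ i, ∫ ω, Z i ω ∂P = 0) (s : Finset ι) :
    Integrable (fun ω => (∑ i ∈ s, (Z i ω ^ 2 - ∫ ω, Z i ω ^ 2 ∂P)) ^ 2) P ∧
    ∫ ω, (∑ i ∈ s, (Z i ω ^ 2 - ∫ ω, Z i ω ^ 2 ∂P)) ^ 2 ∂P =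
      2 * ∑ i ∈ s, ∑ j ∈ s, (∫ ω, Z i ω * Z j ω ∂P) ^ 2 := by
  have := hZ.isProbabilityMeasure
  have hG := hZ.hasGaussianLaw_eval
  set v : ι → ℝ := fun i => ∫ ω, Z i ω ^ 2 ∂P with hv
  change Integrable (fun ω => (∑ i ∈ s, (Z i ω ^ 2 - v i)) ^ 2) P ∧
    ∫ ω, (∑ i ∈ s, (Z i ω ^ 2 - v i)) ^ 2 ∂P = _
  have hexp : ∀ ω, (∑ i ∈ s, (Z i ω ^ 2 - v i)) ^ 2 = ∑ i ∈ s, ∑ j ∈ s,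
      (Z i ω ^ 2 * Z j ω ^ 2 - v j * Z i ω ^ 2 - v i * Z j ω ^ 2 + v i * v j) := fun ω => by
    rw [sq, Finset.sum_mul_sum]
    exact Finset.sum_congr rfl fun i _ => Finset.sum_congr rfl fun j _ => by ring
  have i2 : ∀ i, Integrable (fun ω => Z i ω ^ 2) P := fun i => (hG i).memLp_two.integrable_sq
  have i4 : ∀ i j, Integrable (fun ω => Z i ω ^ 2 * Z j ω ^ 2) P := fun i j =>
    (hG i).integrable_sq_mul_sq (hG j)
  have hint1 : ∀ i j, Integrable (fun ω => Z i ω ^ 2 * Z j ω ^ 2 - v j * Z i ω ^ 2) P :=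
    fun i j => (i4 i j).sub ((i2 i).const_mul _)
  have hint2 : ∀ i j, Integrable (fun ω =>
      Z i ω ^ 2 * Z j ω ^ 2 - v j * Z i ω ^ 2 - v i * Z j ω ^ 2) P :=
    fun i j => (hint1 i j).sub ((i2 j).const_mul _)
  have hint : ∀ i j, Integrable (fun ω =>
      Z i ω ^ 2 * Z j ω ^ 2 - v j * Z i ω ^ 2 - v i * Z j ω ^ 2 + v i * v j) P := fun i j =>
    (hint2 i j).add (integrable_const _)
  simp only [hexp]
  refine ⟨integrable_finsetSum _ fun i _ => integrable_finsetSum _ fun j _ => hint i j, ?_⟩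
  rw [integral_finsetSum _ fun i _ => integrable_finsetSum _ fun j _ => hint i j,
    Finset.mul_sum]
  refine Finset.sum_congr rfl fun i _ => ?_
  rw [integral_finsetSum _ fun j _ => hint i j, Finset.mul_sum]
  refine Finset.sum_congr rfl fun j _ => ?_
  rw [integral_add (hint2 i j) (integrable_const _), integral_sub (hint1 i j)
      ((i2 j).const_mul _), integral_sub (i4 i j) ((i2 i).const_mul _), integral_const_mul,
    integral_const_mul, hZ.hasGaussianLaw_prodMk.integral_sq_mul_sq (h0 i) (h0 j)]
  simp only [hv, integral_const, probReal_univ, one_smul]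
  ring

end Gaussian

/-! ### Averaged increments and their discretisation. -/

lemma MeasureTheory.SimpleFunc.sum_measureReal_mul_eq_integral {α β : Type*} [MeasurableSpace α]
    (ν : Measure α) [IsFiniteMeasure ν] (π : SimpleFunc α β) (F : β → ℝ) :
    ∑ y ∈ π.range, ν.real (π ⁻¹' {y}) * F y = ∫ w, F (π w) ∂ν := by
  have h : ∀ w, F (π w) = ∑ y ∈ π.range, (π ⁻¹' {y}).indicator (fun _ => F y) w := fun w => by
    rw [Finset.sum_eq_single (π w)]
    · simp
    · intro y _ hy
      simp [Set.indicator, hy.symm]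
    · intro hw
      exact absurd (SimpleFunc.mem_range_self π w) hw
  simp_rw [h]
  rw [integral_finsetSum _ fun y _ => (integrable_const _).indicator (π.measurableSet_fiber y)]
  simp [integral_indicator_const _ (π.measurableSet_fiber _)]

/-- The simple functions used to discretise the smoothing kernel. -/
noncomputable def nnrealApprox (m : ℕ) : SimpleFunc ℝ≥0 ℝ≥0 :=
  SimpleFunc.approxOn (id : ℝ≥0 → ℝ≥0) measurable_id Set.univ 0 (Set.mem_univ 0) m

lemma tendsto_nnrealApprox (w : ℝ≥0) : Tendsto (fun m => nnrealApprox m w) atTop (𝓝 w) :=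
  SimpleFunc.tendsto_approxOn measurable_id (Set.mem_univ 0) (by simp)

/-- Domination uniform in m; this factor 2 is the source of the weight (1 + 2w)^4 in the moment
hypotheses on ν. -/
lemma nnrealApprox_le (m : ℕ) (w : ℝ≥0) : (nnrealApprox m w : ℝ) ≤ 2 * w := by
  have h := SimpleFunc.edist_approxOn_y0_le (measurable_id : Measurable (id : ℝ≥0 → ℝ≥0))
    (Set.mem_univ 0) w m
  change edist 0 (nnrealApprox m w) ≤ edist 0 w + edist 0 w at h
  rw [edist_dist, edist_dist, ← ENNReal.ofReal_add dist_nonneg dist_nonneg,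
    ENNReal.ofReal_le_ofReal_iff (by positivity)] at h
  simp only [NNReal.dist_eq, NNReal.coe_zero, zero_sub, abs_neg, NNReal.abs_eq] at h
  linarith

attribute [irreducible] nnrealApprox

lemma continuous_sfBmCov {H : ℝ} (hH : 0 < H) :
    Continuous fun q : ℝ≥0 × ℝ≥0 => sfBmCov H q.1 q.2 := by
  have h2 : 0 ≤ 2 * H := by linarith
  have hr : Continuous fun x : ℝ => x ^ (2 * H) := Real.continuous_rpow_const h2
  unfold sfBmCov
  fun_prop

lemma continuous_sfBmIncrCov {H : ℝ} (hH : 0 < H) (s t : ℝ≥0) :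
    Continuous fun q : ℝ≥0 × ℝ≥0 => sfBmIncrCov H s t q.1 q.2 := by
  have h := continuous_sfBmCov hH
  have h1 : Continuous fun q : ℝ≥0 × ℝ≥0 => sfBmCov H (s - q.1) t :=
    h.comp (f := fun q : ℝ≥0 × ℝ≥0 => (s - q.1, t)) (by fun_prop)
  have h2 : Continuous fun q : ℝ≥0 × ℝ≥0 => sfBmCov H s (t - q.2) :=
    h.comp (f := fun q : ℝ≥0 × ℝ≥0 => (s, t - q.2)) (by fun_prop)
  have h3 : Continuous fun q : ℝ≥0 × ℝ≥0 => sfBmCov H (s - q.1) (t - q.2) :=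
    h.comp (f := fun q : ℝ≥0 × ℝ≥0 => (s - q.1, t - q.2)) (by fun_prop)
  exact ((continuous_const.sub h1).sub h2).add h3

/-- A weighted average of finitely many increments of a process. -/
noncomputable def weightedIncr {Ω : Type*} (ν : Measure ℝ≥0) (S : ℝ≥0 → Ω → ℝ)
    (π : SimpleFunc ℝ≥0 ℝ≥0) (t : ℝ≥0) (ω : Ω) : ℝ :=
  ∑ y ∈ π.range, ν.real (π ⁻¹' {y}) * (S t ω - S (t - y) ω)

section

variable {Ω : Type*} {mΩ : MeasurableSpace Ω} {P : Measure Ω} {H : ℝ} {S : ℝ≥0 → Ω → ℝ}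
  {ν : Measure ℝ≥0} {π : SimpleFunc ℝ≥0 ℝ≥0}

lemma ProbabilityTheory.IsGaussianProcess.weightedIncr (hS : IsGaussianProcess S P) :
    IsGaussianProcess (weightedIncr ν S π) P := by
  classical
  refine hS.of_isGaussianProcess fun t => ⟨insert t (π.range.image fun y => t - y), ?_⟩
  let I : Finset ℝ≥0 := insert t (π.range.image fun y => t - y)
  let i₀ : I := ⟨t, Finset.mem_insert_self _ _⟩
  let i : π.range → I := fun y =>
    ⟨t - y.1, Finset.mem_insert_of_mem (Finset.mem_image_of_mem _ y.2)⟩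
  refine ⟨∑ y ∈ π.range.attach, ν.real (π ⁻¹' {y.1}) •
    ((ContinuousLinearMap.proj i₀ : (I → ℝ) →L[ℝ] ℝ) - ContinuousLinearMap.proj (i y)),
    fun ω => ?_⟩
  simp only [_root_.weightedIncr, sum_apply, smul_apply,
    sub_apply, ContinuousLinearMap.proj_apply, Finset.restrict, smul_eq_mul]
  exact (Finset.sum_attach π.range
    fun y => ν.real (π ⁻¹' {y}) * (S t ω - S (t - y) ω)).symm

lemma IsSubFractionalBM.integral_weightedIncr (hS : IsSubFractionalBM P H S) (t : ℝ≥0) :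
    ∫ ω, weightedIncr ν S π t ω ∂P = 0 := by
  have hi : ∀ u, Integrable (S u) P := fun u => (hS.gaussian.hasGaussianLaw_eval u).integrable
  unfold weightedIncr
  have hint : ∀ y, Integrable (fun ω => ν.real (π ⁻¹' {y}) * (S t ω - S (t - y) ω)) P :=
    fun y => ((hi t).sub (hi (t - y))).const_mul _
  rw [integral_finsetSum _ fun y _ => hint y]
  refine Finset.sum_eq_zero fun y _ => ?_
  rw [integral_const_mul, integral_sub (hi t) (hi _), hS.mean_zero, hS.mean_zero]
  simp

lemma IsSubFractionalBM.integral_incr_mul_incr (hS : IsSubFractionalBM P H S) (s t a b : ℝ≥0) :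
    Integrable (fun ω => (S s ω - S (s - a) ω) * (S t ω - S (t - b) ω)) P ∧
    ∫ ω, (S s ω - S (s - a) ω) * (S t ω - S (t - b) ω) ∂P = sfBmIncrCov H s t a b := by
  have hL : ∀ u, MemLp (S u) 2 P := fun u => (hS.gaussian.hasGaussianLaw_eval u).memLp_two
  have hi : ∀ u v, Integrable (fun ω => S u ω * S v ω) P := fun u v =>
    (hL u).integrable_mul (hL v)
  have h1 : Integrable (fun ω => S s ω * S t ω - S (s - a) ω * S t ω) P := (hi _ _).sub (hi _ _)
  have h2 : Integrable (fun ω => S s ω * S t ω - S (s - a) ω * S t ω -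
      S s ω * S (t - b) ω) P := h1.sub (hi _ _)
  have he : ∀ ω, (S s ω - S (s - a) ω) * (S t ω - S (t - b) ω) =
      S s ω * S t ω - S (s - a) ω * S t ω - S s ω * S (t - b) ω + S (s - a) ω * S (t - b) ω :=
    fun ω => by ring
  simp only [he]
  refine ⟨h2.add (hi _ _), ?_⟩
  rw [integral_add h2 (hi _ _), integral_sub h1 (hi _ _), integral_sub (hi _ _) (hi _ _)]
  simp only [hS.covariance, sfBmIncrCov, sfBmCov_comm H t, sfBmCov_comm H (t - b)]

lemma IsSubFractionalBM.integral_weightedIncr_mul (hS : IsSubFractionalBM P H S) (s t : ℝ≥0) :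
    ∫ ω, weightedIncr ν S π s ω * weightedIncr ν S π t ω ∂P =
      ∑ y ∈ π.range, ν.real (π ⁻¹' {y}) *
        ∑ z ∈ π.range, ν.real (π ⁻¹' {z}) * sfBmIncrCov H s t y z := by
  have he : ∀ ω, weightedIncr ν S π s ω * weightedIncr ν S π t ω =
      ∑ y ∈ π.range, ∑ z ∈ π.range, ν.real (π ⁻¹' {y}) * (ν.real (π ⁻¹' {z}) *
        ((S s ω - S (s - y) ω) * (S t ω - S (t - z) ω))) := fun ω => by
    rw [weightedIncr, weightedIncr, Finset.sum_mul_sum]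
    exact Finset.sum_congr rfl fun _ _ => Finset.sum_congr rfl fun _ _ => by ring
  have hint : ∀ y z, Integrable (fun ω => ν.real (π ⁻¹' {y}) * (ν.real (π ⁻¹' {z}) *
        ((S s ω - S (s - y) ω) * (S t ω - S (t - z) ω)))) P := fun y z =>
    (((hS.integral_incr_mul_incr s t y z).1.const_mul _).const_mul _)
  simp only [he]
  rw [integral_finsetSum _ fun y _ => integrable_finsetSum _ fun z _ => hint y z]
  refine Finset.sum_congr rfl fun y _ => ?_
  rw [integral_finsetSum _ fun z _ => hint y z, Finset.mul_sum]
  refine Finset.sum_congr rfl fun z _ => ?_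
  rw [integral_const_mul, integral_const_mul, (hS.integral_incr_mul_incr s t y z).2]

lemma integrable_prod_pow [SFinite ν]
    (hν : Integrable (fun w : ℝ≥0 => (1 + 2 * w : ℝ) ^ 4) ν) :
    Integrable (fun q : ℝ≥0 × ℝ≥0 => 32 * ((1 + 2 * q.1 : ℝ) ^ 4 * (1 + 2 * q.2 : ℝ) ^ 4))
      (ν.prod ν) := (hν.mul_prod hν).const_mul 32

variable [IsProbabilityMeasure ν]

lemma sum_measureReal_mul_pow_le (hν : Integrable (fun w : ℝ≥0 => (1 + 2 * w : ℝ) ^ 4) ν)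
    (hπ : ∀ w, (π w : ℝ) ≤ 2 * w) :
    ∑ y ∈ π.range, ν.real (π ⁻¹' {y}) * (1 + y : ℝ) ^ 4 ≤ ∫ w, (1 + 2 * w : ℝ) ^ 4 ∂ν := by
  rw [SimpleFunc.sum_measureReal_mul_eq_integral ν π fun y : ℝ≥0 => (1 + y : ℝ) ^ 4]
  refine integral_mono_of_nonneg (ae_of_all _ fun w => by positivity) hν (ae_of_all _ fun w => ?_)
  have := hπ w
  dsimp only
  gcongr

/-- The polynomial factors in the increment lengths are averaged out against ν, leaving a constant
independent of the discretisation π. -/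
lemma IsSubFractionalBM.abs_integral_weightedIncr_mul_le (hH0 : 0 < H) (hH1 : H < 1)
    (hS : IsSubFractionalBM P H S)
    (hν : Integrable (fun w : ℝ≥0 => (1 + 2 * w : ℝ) ^ 4) ν) (hπ : ∀ w, (π w : ℝ) ≤ 2 * w)
    (s t : ℝ≥0) :
    |∫ ω, weightedIncr ν S π s ω * weightedIncr ν S π t ω ∂P| ≤
      32 * (∫ w, (1 + 2 * w : ℝ) ^ 4 ∂ν) ^ 2 * (1 + |(t : ℝ) - s|) ^ (2 * H - 2) := by
  rw [hS.integral_weightedIncr_mul]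
  have hK : 0 ≤ (1 + |(t : ℝ) - s|) ^ (2 * H - 2) := by positivity
  have h0 := sum_measureReal_mul_pow_le hν hπ
  set A := ∑ y ∈ π.range, ν.real (π ⁻¹' {y}) * (1 + y : ℝ) ^ 4 with hA
  have hA0 : 0 ≤ A := Finset.sum_nonneg fun y _ => by positivity
  calc |∑ y ∈ π.range, ν.real (π ⁻¹' {y}) *
        ∑ z ∈ π.range, ν.real (π ⁻¹' {z}) * sfBmIncrCov H s t y z|
      ≤ ∑ y ∈ π.range, ν.real (π ⁻¹' {y}) * ∑ z ∈ π.range, ν.real (π ⁻¹' {z}) *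
        (32 * (1 + y : ℝ) ^ 4 * (1 + z : ℝ) ^ 4 * (1 + |(t : ℝ) - s|) ^ (2 * H - 2)) := by
        refine (Finset.abs_sum_le_sum_abs _ _).trans (Finset.sum_le_sum fun y _ => ?_)
        rw [abs_mul, abs_of_nonneg measureReal_nonneg]
        refine mul_le_mul_of_nonneg_left ?_ measureReal_nonneg
        refine (Finset.abs_sum_le_sum_abs _ _).trans (Finset.sum_le_sum fun z _ => ?_)
        rw [abs_mul, abs_of_nonneg measureReal_nonneg]
        exact mul_le_mul_of_nonneg_left (abs_sfBmIncrCov_le hH0 hH1 s t y z) measureReal_nonneg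
    _ = 32 * A ^ 2 * (1 + |(t : ℝ) - s|) ^ (2 * H - 2) := by
        rw [sq, hA, Finset.sum_mul_sum, Finset.mul_sum, Finset.sum_mul]
        refine Finset.sum_congr rfl fun y _ => ?_
        rw [Finset.mul_sum, Finset.mul_sum, Finset.sum_mul]
        exact Finset.sum_congr rfl fun z _ => by ring
    _ ≤ _ := by gcongr

/-- The variance at time `t` of the process obtained by averaging increments against `ν`. -/
noncomputable def smoothedVar (H : ℝ) (ν : Measure ℝ≥0) (t : ℝ≥0) : ℝ :=
  ∫ q, sfBmIncrCov H t t q.1 q.2 ∂(ν.prod ν)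

lemma abs_sfBmIncrCov_self_le (hH0 : 0 < H) (hH1 : H < 1) (t a b : ℝ≥0) {x y : ℝ}
    (ha : (a : ℝ) ≤ 2 * x) (hb : (b : ℝ) ≤ 2 * y) :
    |sfBmIncrCov H t t a b| ≤ 32 * ((1 + 2 * x) ^ 4 * (1 + 2 * y) ^ 4) := by
  refine (abs_sfBmIncrCov_le hH0 hH1 t t a b).trans ?_
  simp only [sub_self, abs_zero, add_zero, Real.one_rpow, mul_one, mul_assoc]
  gcongr

lemma IsSubFractionalBM.tendsto_integral_weightedIncr_sq (hH0 : 0 < H) (hH1 : H < 1)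
    (hS : IsSubFractionalBM P H S)
    (hν : Integrable (fun w : ℝ≥0 => (1 + 2 * w : ℝ) ^ 4) ν) (t : ℝ≥0) :
    Tendsto (fun m => ∫ ω, weightedIncr ν S (nnrealApprox m) t ω ^ 2 ∂P) atTop
      (𝓝 (smoothedVar H ν t)) := by
  have hc := continuous_sfBmIncrCov hH0 t t
  have hmeas : ∀ m, Measurable fun q : ℝ≥0 × ℝ≥0 =>
      sfBmIncrCov H t t (nnrealApprox m q.1) (nnrealApprox m q.2) := fun m =>
    hc.measurable.comp (f := fun q : ℝ≥0 × ℝ≥0 => (nnrealApprox m q.1, nnrealApprox m q.2))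
      (((nnrealApprox m).measurable.comp measurable_fst).prodMk
        ((nnrealApprox m).measurable.comp measurable_snd))
  have hbd : ∀ m (q : ℝ≥0 × ℝ≥0),
      ‖sfBmIncrCov H t t (nnrealApprox m q.1) (nnrealApprox m q.2)‖ ≤
        32 * ((1 + 2 * q.1 : ℝ) ^ 4 * (1 + 2 * q.2 : ℝ) ^ 4) := fun m q =>
    abs_sfBmIncrCov_self_le hH0 hH1 t _ _ (x := q.1) (y := q.2) (nnrealApprox_le m _) (nnrealApprox_le m _)
  have heq : ∀ m, ∫ ω, weightedIncr ν S (nnrealApprox m) t ω ^ 2 ∂P =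
      ∫ q, sfBmIncrCov H t t (nnrealApprox m q.1) (nnrealApprox m q.2) ∂(ν.prod ν) := fun m => by
    simp only [sq, hS.integral_weightedIncr_mul]
    rw [integral_prod _ ((integrable_prod_pow hν).mono' (hmeas m).aestronglyMeasurable
        (ae_of_all _ (hbd m))),
      SimpleFunc.sum_measureReal_mul_eq_integral ν (nnrealApprox m) fun y =>
        ∑ z ∈ (nnrealApprox m).range, ν.real (nnrealApprox m ⁻¹' {z}) * sfBmIncrCov H t t y z]
    refine integral_congr_ae (ae_of_all _ fun w => ?_)
    exact SimpleFunc.sum_measureReal_mul_eq_integral ν (nnrealApprox m) fun z =>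
      sfBmIncrCov H t t (nnrealApprox m w) z
  have hlim : ∀ q : ℝ≥0 × ℝ≥0, Tendsto (fun m =>
      sfBmIncrCov H t t (nnrealApprox m q.1) (nnrealApprox m q.2)) atTop
      (𝓝 (sfBmIncrCov H t t q.1 q.2)) := fun q => (hc.tendsto q).comp
    (f := fun m => (nnrealApprox m q.1, nnrealApprox m q.2))
    ((tendsto_nnrealApprox q.1).prodMk_nhds (tendsto_nnrealApprox q.2))
  rw [smoothedVar]
  simp only [heq]
  exact tendsto_integral_of_dominated_convergence
    (fun q => 32 * ((1 + 2 * q.1 : ℝ) ^ 4 * (1 + 2 * q.2 : ℝ) ^ 4))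
    (fun m => (hmeas m).aestronglyMeasurable)
    (integrable_prod_pow hν) (fun m => ae_of_all _ (hbd m)) (ae_of_all _ hlim)

lemma tendsto_smoothedVar (hH0 : 0 < H) (hH1 : H < 1)
    (hν : Integrable (fun w : ℝ≥0 => (1 + 2 * w : ℝ) ^ 4) ν) :
    Tendsto (fun n : ℕ => smoothedVar H ν n) atTop (𝓝 (∫ q : ℝ≥0 × ℝ≥0,
      1 / 2 * ((q.1 : ℝ) ^ (2 * H) + (q.2 : ℝ) ^ (2 * H) - |(q.1 : ℝ) - q.2| ^ (2 * H))
        ∂(ν.prod ν))) := by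
  refine tendsto_integral_of_dominated_convergence _
    (fun n => (continuous_sfBmIncrCov hH0 n n).aestronglyMeasurable) (integrable_prod_pow hν)
    (fun n => ae_of_all _ fun q => ?_) (ae_of_all _ fun q => ?_)
  · exact abs_sfBmIncrCov_self_le hH0 hH1 n _ _ (x := q.1) (y := q.2) (by linarith [q.1.2]) (by linarith [q.2.2])
  · exact tendsto_sfBmIncrCov_self hH0 hH1 q.1 q.2

lemma tendsto_weightedIncr {ω : Ω} (hω : Continuous fun t => S t ω) (t : ℝ≥0) :
    Tendsto (fun m => weightedIncr ν S (nnrealApprox m) t ω) atTop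
      (𝓝 (∫ w, (S t ω - S (t - w) ω) ∂ν)) := by
  have hc : Continuous fun w : ℝ≥0 => S t ω - S (t - w) ω :=
    continuous_const.sub (hω.comp (f := fun w : ℝ≥0 => t - w) (by fun_prop))
  have heq : ∀ m, weightedIncr ν S (nnrealApprox m) t ω =
      ∫ w, (S t ω - S (t - nnrealApprox m w) ω) ∂ν := fun m =>
    SimpleFunc.sum_measureReal_mul_eq_integral ν (nnrealApprox m) fun y => S t ω - S (t - y) ω
  -- Truncated times t - w stay in [0, t], so a continuous path gives a bounded integrand for all w.
  obtain ⟨C, hC⟩ := (isCompact_Icc (a := (0 : ℝ≥0)) (b := t)).exists_bound_of_continuousOn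
    (f := fun u => S t ω - S u ω) (continuous_const.sub hω).continuousOn
  simp only [heq]
  refine tendsto_integral_of_dominated_convergence (fun _ => C)
    (fun m => (hc.measurable.comp (nnrealApprox m).measurable).aestronglyMeasurable)
    (integrable_const _) (fun m => ae_of_all _ fun w => hC _ ⟨zero_le, tsub_le_self⟩)
    (ae_of_all _ fun w => (hc.tendsto w).comp (tendsto_nnrealApprox w))

/-- The discretised averages form Gaussian processes, for which the variance formula is exact and
its bound uniform in m. Almost sure convergence and Fatou's lemma carry the bound over to X. -/
lemma IsSubFractionalBM.lintegral_sq_sum_sq_sub_le {X : ℝ≥0 → Ω → ℝ} (hH0 : 0 < H) (hH1 : H < 1)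
    (hS : IsSubFractionalBM P H S)
    (hν : Integrable (fun w : ℝ≥0 => (1 + 2 * w : ℝ) ^ 4) ν)
    (hX : ∀ᵐ ω ∂P, ∀ t, X t ω = ∫ w, (S t ω - S (t - w) ω) ∂ν) (s : Finset ℕ) :
    AEMeasurable (fun ω => (∑ i ∈ s, (X i ω ^ 2 - smoothedVar H ν i)) ^ 2) P ∧
    ∫⁻ ω, ENNReal.ofReal ((∑ i ∈ s, (X i ω ^ 2 - smoothedVar H ν i)) ^ 2) ∂P ≤
      ENNReal.ofReal (2 * ∑ i ∈ s, ∑ j ∈ s,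
        (32 * (∫ w, (1 + 2 * w : ℝ) ^ 4 ∂ν) ^ 2 *
          (1 + |(j : ℝ) - i|) ^ (2 * H - 2)) ^ 2) := by
  set Z : ℕ → ℕ → Ω → ℝ := fun m i => weightedIncr ν S (nnrealApprox m) i with hZ
  have hGP : ∀ m, IsGaussianProcess (Z m) P := fun m =>
    hS.gaussian.weightedIncr.comp_right (fun i : ℕ => (i : ℝ≥0))
  have hvar := fun m => (hGP m).integral_sq_sum_sq_sub (fun i => hS.integral_weightedIncr i) s
  set Q : ℕ → Ω → ℝ := fun m ω => (∑ i ∈ s, (Z m i ω ^ 2 - ∫ ω, Z m i ω ^ 2 ∂P)) ^ 2 with hQ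
  have hlim : ∀ᵐ ω ∂P, Tendsto (fun m => Q m ω) atTop
      (𝓝 ((∑ i ∈ s, (X i ω ^ 2 - smoothedVar H ν i)) ^ 2)) := by
    filter_upwards [hX, hS.continuous_paths] with ω hω hc
    refine (tendsto_finsetSum _ fun i _ => Tendsto.sub ?_ ?_).pow 2
    · rw [hω]
      exact (tendsto_weightedIncr hc i).pow 2
    · exact hS.tendsto_integral_weightedIncr_sq hH0 hH1 hν i
  have hQm : ∀ m, AEMeasurable (Q m) P := fun m => (hvar m).1.aemeasurable
  refine ⟨aemeasurable_of_tendsto_metrizable_ae atTop hQm hlim, ?_⟩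
  calc ∫⁻ ω, ENNReal.ofReal ((∑ i ∈ s, (X i ω ^ 2 - smoothedVar H ν i)) ^ 2) ∂P
      = ∫⁻ ω, liminf (fun m => ENNReal.ofReal (Q m ω)) atTop ∂P := by
        refine lintegral_congr_ae ?_
        filter_upwards [hlim] with ω hω
        exact ((ENNReal.continuous_ofReal.tendsto _).comp hω).liminf_eq.symm
    _ ≤ liminf (fun m => ∫⁻ ω, ENNReal.ofReal (Q m ω) ∂P) atTop :=
        lintegral_liminf_le' fun m => (hQm m).ennreal_ofReal
    _ ≤ _ := by
        refine (liminf_le_liminf (Eventually.of_forall fun m => ?_)).trans_eq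
          (liminf_const (f := atTop (α := ℕ)) _)
        rw [← ofReal_integral_eq_lintegral_ofReal (hvar m).1 (ae_of_all _ fun ω => sq_nonneg _)]
        refine ENNReal.ofReal_le_ofReal ?_
        rw [(hvar m).2]
        refine mul_le_mul_of_nonneg_left (Finset.sum_le_sum fun i _ => Finset.sum_le_sum
          fun j _ => ?_) zero_le_two
        have h := abs_le.1 (hS.abs_integral_weightedIncr_mul_le hH0 hH1 hν (nnrealApprox_le m) i j)
        simp only [NNReal.coe_natCast] at h
        exact sq_le_sq' h.1 h.2

end

/-! ### Sums of negative powers. -/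

lemma sum_range_rpow_neg_le {β : ℝ} (hβ0 : 0 < β) (hβ1 : β < 1) (n : ℕ) :
    ∑ k ∈ Finset.range n, (1 + (k : ℝ)) ^ (-β) ≤ (n : ℝ) ^ (1 - β) / (1 - β) := by
  have hb : 0 < 1 - β := by linarith
  induction n with
  | zero => simp [Real.zero_rpow hb.ne']
  | succ n ih =>
    rw [Finset.sum_range_succ]
    have hn : (0 : ℝ) < 1 + n := by positivity
    -- Bernoulli's inequality for the exponent 1 - β in [0, 1], applied to n / (n+1) = 1 - 1/(n+1);
    -- the resulting bound telescopes.
    have hbern : (n : ℝ) ^ (1 - β) ≤ (1 + n : ℝ) ^ (1 - β) - (1 - β) * (1 + n : ℝ) ^ (-β) := by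
      have h1 : (n : ℝ) = (1 + n) * (1 + -(1 / (1 + n))) := by field_simp; ring
      have h2 : (1 : ℝ) / (1 + n) ≤ 1 := by
        rw [div_le_one hn]; linarith [(Nat.cast_nonneg n : (0 : ℝ) ≤ n)]
      have h3 := rpow_one_add_le_one_add_mul_self (s := -(1 / (1 + (n : ℝ)))) (p := 1 - β)
        (by linarith) hb.le (by linarith)
      have h4 : (1 + n : ℝ) ^ (1 - β) = (1 + n : ℝ) ^ (-β) * (1 + n) := by
        rw [show 1 - β = -β + 1 by ring, Real.rpow_add hn, Real.rpow_one]
      calc (n : ℝ) ^ (1 - β) = (1 + n : ℝ) ^ (1 - β) * (1 + -(1 / (1 + n : ℝ))) ^ (1 - β) := by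
            rw [← Real.mul_rpow hn.le (by linarith), ← h1]
        _ ≤ (1 + n : ℝ) ^ (1 - β) * (1 + (1 - β) * -(1 / (1 + n : ℝ))) := by gcongr
        _ = _ := by rw [h4]; field_simp; ring
    have : (1 + (n : ℝ)) ^ (-β) ≤ ((1 + n : ℝ) ^ (1 - β) - (n : ℝ) ^ (1 - β)) / (1 - β) := by
      rw [le_div_iff₀ hb]; linarith
    rw [sub_div] at this
    push_cast
    rw [add_comm (n : ℝ) 1]
    linarith

/-- Every distance to i is below n and is attained at most once on each side of i. -/
lemma sum_abs_sub_le_two_mul_sum_range {f : ℝ → ℝ} (hf : ∀ x, 0 ≤ x → 0 ≤ f x) {n i : ℕ}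
    (hi : i ∈ Finset.Icc 1 n) :
    ∑ j ∈ Finset.Icc 1 n, f |(j : ℝ) - i| ≤ 2 * ∑ k ∈ Finset.range n, f k := by
  rw [Finset.mem_Icc] at hi
  have hpart : ∀ (s : Finset ℕ) (g : ℕ → ℕ), Set.InjOn g s → (∀ j ∈ s, g j < n) →
      (∀ j ∈ s, |(j : ℝ) - i| = g j) →
      ∑ j ∈ s, f |(j : ℝ) - i| ≤ ∑ k ∈ Finset.range n, f k := fun s g hinj hlt hg => by
    rw [Finset.sum_congr rfl fun j hj => by rw [hg j hj],
      ← Finset.sum_image (f := fun k : ℕ => f k) hinj]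
    refine Finset.sum_le_sum_of_subset_of_nonneg (fun k hk => ?_) fun k _ _ => hf _ (by positivity)
    obtain ⟨j, hj, rfl⟩ := Finset.mem_image.1 hk
    exact Finset.mem_range.2 (hlt j hj)
  rw [← Finset.sum_filter_add_sum_filter_not (Finset.Icc 1 n) (fun j => j ≤ i), two_mul]
  refine add_le_add (hpart _ (fun j => i - j) ?_ ?_ ?_) (hpart _ (fun j => j - i) ?_ ?_ ?_)
  · intro a ha b hb hab
    simp only [Finset.coe_filter, Finset.mem_Icc, Set.mem_ofPred_eq] at ha hb hab
    omega
  · intro j hj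
    simp only [Finset.mem_filter, Finset.mem_Icc] at hj
    omega
  · intro j hj
    simp only [Finset.mem_filter, Finset.mem_Icc] at hj
    rw [abs_sub_comm, Nat.cast_sub hj.2, abs_of_nonneg (by simpa using hj.2)]
  · intro a ha b hb hab
    simp only [Finset.coe_filter, Finset.mem_Icc, Set.mem_ofPred_eq] at ha hb hab
    omega
  · intro j hj
    simp only [Finset.mem_filter, Finset.mem_Icc] at hj
    omega
  · intro j hj
    simp only [Finset.mem_filter, Finset.mem_Icc, not_le] at hj
    rw [Nat.cast_sub hj.2.le, abs_of_nonneg (by simpa using hj.2.le)]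

lemma sum_sum_rpow_neg_le {β : ℝ} (hβ0 : 0 < β) (hβ1 : β < 1) (n : ℕ) :
    ∑ i ∈ Finset.Icc 1 n, ∑ j ∈ Finset.Icc 1 n, (1 + |(j : ℝ) - i|) ^ (-β) ≤
      2 / (1 - β) * ((n : ℝ) ^ 2 * (n : ℝ) ^ (-β)) := by
  have hb : 0 < 1 - β := by linarith
  rcases Nat.eq_zero_or_pos n with rfl | hn
  · simp
  have hn' : (0 : ℝ) < n := by exact_mod_cast hn
  calc ∑ i ∈ Finset.Icc 1 n, ∑ j ∈ Finset.Icc 1 n, (1 + |(j : ℝ) - i|) ^ (-β)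
      ≤ ∑ i ∈ Finset.Icc 1 n, 2 * ((n : ℝ) ^ (1 - β) / (1 - β)) :=
        Finset.sum_le_sum fun i hi => (sum_abs_sub_le_two_mul_sum_range
          (f := fun x => (1 + x) ^ (-β)) (fun x hx => by positivity) hi).trans
          (mul_le_mul_of_nonneg_left (sum_range_rpow_neg_le hβ0 hβ1 n) zero_le_two)
    _ = _ := by
        rw [Finset.sum_const, Nat.card_Icc, nsmul_eq_mul, add_tsub_cancel_right, sub_eq_add_neg 1 β,
          Real.rpow_add hn', Real.rpow_one]
        ring

/-! ### Strong law from a second moment bound. -/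

section

variable {Ω : Type*} {mΩ : MeasurableSpace Ω} {P : Measure Ω}

/-- The sum of the functions has finite integral, so it converges almost surely and its terms tend
to 0. -/
lemma ae_tendsto_zero_of_summable_lintegral {f : ℕ → Ω → ℝ} {b : ℕ → ℝ}
    (hf : ∀ k, AEMeasurable (f k) P) (h0 : ∀ k ω, 0 ≤ f k ω) (hb0 : ∀ k, 0 ≤ b k) (hb : Summable b)
    (hle : ∀ k, ∫⁻ ω, ENNReal.ofReal (f k ω) ∂P ≤ ENNReal.ofReal (b k)) :
    ∀ᵐ ω ∂P, Tendsto (fun k => f k ω) atTop (𝓝 0) := by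
  have hfin : ∫⁻ ω, ∑' k, ENNReal.ofReal (f k ω) ∂P ≠ ⊤ := by
    rw [lintegral_tsum fun k => (hf k).ennreal_ofReal]
    refine ne_top_of_le_ne_top ?_ (ENNReal.tsum_le_tsum hle)
    rw [← ENNReal.ofReal_tsum_of_nonneg hb0 hb]
    exact ENNReal.ofReal_ne_top
  filter_upwards [ae_lt_top' (AEMeasurable.tsum fun k => (hf k).ennreal_ofReal) hfin]
    with ω hω
  have := ENNReal.tendsto_atTop_zero_of_tsum_ne_top hω.ne
  have h2 := (ENNReal.tendsto_toReal ENNReal.zero_ne_top).comp this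
  simpa [Function.comp_def, ENNReal.toReal_ofReal (h0 _ ω)] using h2

/-- A strong law of large numbers for nonnegative random variables whose centred partial sums
have a second moment that is smaller than `n ^ 2` by a power of `n`. -/
lemma ae_tendsto_average_of_lintegral_sq_le {A : ℕ → Ω → ℝ} {v : ℕ → ℝ} {l C δ : ℝ}
    (hA : ∀ i ω, 0 ≤ A i ω) (hv : Tendsto v atTop (𝓝 l)) (hC : 0 ≤ C) (hδ : 0 < δ)
    (hm : ∀ n, AEMeasurable (fun ω => (∑ i ∈ Finset.Icc 1 n, (A i ω - v i)) ^ 2) P)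
    (hle : ∀ n : ℕ, ∫⁻ ω, ENNReal.ofReal ((∑ i ∈ Finset.Icc 1 n, (A i ω - v i)) ^ 2) ∂P ≤
      ENNReal.ofReal (C * ((n : ℝ) ^ 2 * (n : ℝ) ^ (-δ)))) :
    ∀ᵐ ω ∂P, Tendsto (fun n : ℕ => (∑ i ∈ Finset.Icc 1 n, A i ω) / n) atTop (𝓝 l) := by
  have hces : Tendsto (fun n : ℕ => (∑ i ∈ Finset.Icc 1 n, v i) / n) atTop (𝓝 l) := by
    have := ((tendsto_add_atTop_iff_nat 1).2 hv).cesaro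
    refine this.congr fun n => ?_
    rw [inv_mul_eq_div, Finset.range_eq_Ico, Finset.sum_Ico_add' v 0 n 1]
    rfl
  have hsub : ∀ c : ℝ, 1 < c → ∀ᵐ ω ∂P, Tendsto (fun k : ℕ =>
      (∑ i ∈ Finset.Icc 1 ⌊c ^ k⌋₊, A i ω) / ⌊c ^ k⌋₊) atTop (𝓝 l) := fun c hc => by
    have hc0 : 0 < c := by linarith
    -- This lower bound turns the floor's power -δ into a geometric sequence, at the cost of the
    -- factor 2 ^ δ.
    have hfl : ∀ k : ℕ, c ^ k / 2 ≤ (⌊c ^ k⌋₊ : ℝ) ∧ (0 : ℝ) < ⌊c ^ k⌋₊ := fun k => by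
      have h1 : 1 ≤ c ^ k := one_le_pow₀ hc.le
      have h2 : (1 : ℝ) ≤ ⌊c ^ k⌋₊ := by exact_mod_cast Nat.one_le_floor_iff _ |>.2 h1
      exact ⟨by linarith [Nat.lt_floor_add_one (c ^ k)], by linarith⟩
    have hz := ae_tendsto_zero_of_summable_lintegral (P := P)
      (f := fun k ω => ((∑ i ∈ Finset.Icc 1 ⌊c ^ k⌋₊, (A i ω - v i)) / ⌊c ^ k⌋₊) ^ 2)
      (b := fun k => C * 2 ^ δ * (c ^ (-δ)) ^ k)
      (fun k => by simp only [div_pow]; exact (hm _).div_const _)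
      (fun k ω => sq_nonneg _) (fun k => by positivity)
      ((summable_geometric_of_lt_one (by positivity)
        (Real.rpow_lt_one_of_one_lt_of_neg hc (by linarith))).mul_left _)
      (fun k => by
        obtain ⟨h1, h2⟩ := hfl k
        set N : ℝ := (⌊c ^ k⌋₊ : ℝ)
        have he : ∀ ω, ENNReal.ofReal (((∑ i ∈ Finset.Icc 1 ⌊c ^ k⌋₊, (A i ω - v i)) / N) ^ 2) =
            ENNReal.ofReal ((N ^ 2)⁻¹) *
              ENNReal.ofReal ((∑ i ∈ Finset.Icc 1 ⌊c ^ k⌋₊, (A i ω - v i)) ^ 2) := fun ω => by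
          rw [← ENNReal.ofReal_mul (by positivity), div_pow, div_eq_inv_mul]
        simp only [he]
        rw [lintegral_const_mul' _ _ ENNReal.ofReal_ne_top]
        refine (mul_le_mul_right (hle _) _).trans ?_
        rw [← ENNReal.ofReal_mul (by positivity)]
        refine ENNReal.ofReal_le_ofReal ?_
        calc (N ^ 2)⁻¹ * (C * (N ^ 2 * N ^ (-δ))) = C * N ^ (-δ) := by field_simp
          _ ≤ C * (c ^ k / 2) ^ (-δ) := by
              refine mul_le_mul_of_nonneg_left ?_ hC
              exact Real.rpow_le_rpow_of_nonpos (by positivity) h1 (by linarith)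
          _ = C * 2 ^ δ * (c ^ (-δ)) ^ k := by
              rw [Real.div_rpow (by positivity) (by norm_num), Real.rpow_neg zero_le_two δ,
                ← Real.rpow_natCast, ← Real.rpow_natCast, ← Real.rpow_mul hc0.le,
                ← Real.rpow_mul hc0.le, mul_comm (k : ℝ)]
              field_simp)
    filter_upwards [hz] with ω hω
    have h1 : Tendsto (fun k : ℕ => (∑ i ∈ Finset.Icc 1 ⌊c ^ k⌋₊, (A i ω - v i)) /
        (⌊c ^ k⌋₊ : ℝ)) atTop (𝓝 0) := by
      have := hω.sqrt
      simp only [Real.sqrt_sq_eq_abs, Real.sqrt_zero] at this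
      exact (tendsto_zero_iff_abs_tendsto_zero _).2 this
    have h2 := hces.comp ((tendsto_nat_floor_atTop (α := ℝ)).comp
      (tendsto_pow_atTop_atTop_of_one_lt hc))
    have h3 := h1.add h2
    rw [zero_add] at h3
    refine h3.congr fun k => ?_
    simp only [Function.comp_apply, Finset.sum_sub_distrib]
    ring
  -- Countably many ratios decreasing to 1 share one null set; monotonicity of the partial sums then
  -- fills the gaps between subsequence times.
  have hall : ∀ᵐ ω ∂P, ∀ m : ℕ, Tendsto (fun k : ℕ =>
      (∑ i ∈ Finset.Icc 1 ⌊(1 + 1 / ((m : ℝ) + 1)) ^ k⌋₊, A i ω) /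
        ⌊(1 + 1 / ((m : ℝ) + 1)) ^ k⌋₊) atTop (𝓝 l) :=
    ae_all_iff.2 fun m => hsub _ (by simp; positivity)
  filter_upwards [hall] with ω hω
  refine tendsto_div_of_monotone_of_tendsto_div_floor_pow
    (fun n => ∑ i ∈ Finset.Icc 1 n, A i ω) l (fun a b hab => ?_)
    (fun m => 1 + 1 / ((m : ℝ) + 1)) (fun m => by simp; positivity) ?_ hω
  · exact Finset.sum_le_sum_of_subset_of_nonneg (Finset.Icc_subset_Icc le_rfl hab)
      fun i _ _ => hA i ω
  · simpa using (tendsto_one_div_add_atTop_nhds_zero_nat (𝕜 := ℝ)).const_add 1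

lemma IsSubFractionalBM.ae_tendsto_average_sq {H : ℝ} {S X : ℝ≥0 → Ω → ℝ} {ν : Measure ℝ≥0}
    [IsProbabilityMeasure ν] (hH0 : 0 < H) (hH1 : H < 1) (hS : IsSubFractionalBM P H S)
    (hν : Integrable (fun w : ℝ≥0 => (1 + 2 * w : ℝ) ^ 4) ν)
    (hX : ∀ᵐ ω ∂P, ∀ t, X t ω = ∫ w, (S t ω - S (t - w) ω) ∂ν) :
    ∀ᵐ ω ∂P, Tendsto (fun n : ℕ => (∑ i ∈ Finset.Icc 1 n, X i ω ^ 2) / n) atTop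
      (𝓝 (∫ q : ℝ≥0 × ℝ≥0, 1 / 2 * ((q.1 : ℝ) ^ (2 * H) + (q.2 : ℝ) ^ (2 * H) -
        |(q.1 : ℝ) - q.2| ^ (2 * H)) ∂(ν.prod ν))) := by
  have hmain := hS.lintegral_sq_sum_sq_sub_le hH0 hH1 hν hX
  set K := 32 * (∫ w, (1 + 2 * w : ℝ) ^ 4 ∂ν) ^ 2 with hK
  -- Squared covariances decay with exponent 4 - 4H, which may reach or exceed 1. The cap 1 / 2
  -- keeps β < 1 for the power sum bound; any cap in (0, 1) would do.
  set β := min (4 - 4 * H) (1 / 2) with hβ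
  have hβ0 : 0 < β := lt_min (by linarith) (by norm_num)
  have hβ1 : β < 1 := (min_le_right _ _).trans_lt (by norm_num)
  have h1β : 0 < 1 - β := by linarith
  refine ae_tendsto_average_of_lintegral_sq_le (A := fun i ω => X i ω ^ 2)
    (v := fun i => smoothedVar H ν i) (C := 2 * (K ^ 2 * (2 / (1 - β)))) (δ := β)
    (fun i ω => sq_nonneg _) (tendsto_smoothedVar hH0 hH1 hν) (by positivity) hβ0
    (fun n => (hmain _).1) fun n => (hmain _).2.trans (ENNReal.ofReal_le_ofReal ?_)
  calc 2 * ∑ i ∈ Finset.Icc 1 n, ∑ j ∈ Finset.Icc 1 n,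
        (K * (1 + |(j : ℝ) - i|) ^ (2 * H - 2)) ^ 2
      ≤ 2 * ∑ i ∈ Finset.Icc 1 n, ∑ j ∈ Finset.Icc 1 n,
        K ^ 2 * (1 + |(j : ℝ) - i|) ^ (-β) := by
        refine mul_le_mul_of_nonneg_left (Finset.sum_le_sum fun i _ => Finset.sum_le_sum
          fun j _ => ?_) zero_le_two
        rw [mul_pow]
        refine mul_le_mul_of_nonneg_left ?_ (sq_nonneg _)
        rw [← Real.rpow_natCast, ← Real.rpow_mul (by positivity)]
        refine Real.rpow_le_rpow_of_exponent_le (by simp) ?_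
        have := min_le_left (4 - 4 * H) (1 / 2)
        push_cast
        linarith
    _ = 2 * (K ^ 2 * ∑ i ∈ Finset.Icc 1 n, ∑ j ∈ Finset.Icc 1 n,
        (1 + |(j : ℝ) - i|) ^ (-β)) := by simp only [Finset.mul_sum]
    _ ≤ 2 * (K ^ 2 * (2 / (1 - β) * ((n : ℝ) ^ 2 * (n : ℝ) ^ (-β)))) := by
        gcongr
        exact sum_sum_rpow_neg_le hβ0 hβ1 n
    _ = _ := by ring

end

/-! ### The exponential kernel and the limiting variance. -/

/-- The exponential distribution with rate `θ`, as a measure on `ℝ≥0`. -/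
noncomputable def nnrealExpMeasure (θ : ℝ) : Measure ℝ≥0 :=
  ((volume.restrict (Set.Ioi (0 : ℝ))).withDensity
    fun w => ((θ * Real.exp (-(θ * w))).toNNReal : ENNReal)).map Real.toNNReal

section

variable {θ : ℝ}

lemma measurable_exp_density (θ : ℝ) :
    Measurable fun w : ℝ => (θ * Real.exp (-(θ * w))).toNNReal := by fun_prop

lemma integral_nnrealExpMeasure (hθ : 0 < θ) {f : ℝ≥0 → ℝ} (hf : Measurable f) :
    ∫ w, f w ∂(nnrealExpMeasure θ) =
      ∫ w in Set.Ioi (0 : ℝ), θ * Real.exp (-(θ * w)) * f w.toNNReal := by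
  rw [nnrealExpMeasure, integral_map measurable_real_toNNReal.aemeasurable
    hf.aestronglyMeasurable, integral_withDensity_eq_integral_smul (measurable_exp_density θ)]
  refine integral_congr_ae (ae_of_all _ fun w => ?_)
  simp only [NNReal.smul_def, smul_eq_mul]
  rw [Real.coe_toNNReal _ (by positivity)]

lemma integrable_nnrealExpMeasure_iff (hθ : 0 < θ) {f : ℝ≥0 → ℝ} (hf : Measurable f) :
    Integrable f (nnrealExpMeasure θ) ↔
      IntegrableOn (fun w => θ * Real.exp (-(θ * w)) * f w.toNNReal) (Set.Ioi 0) := by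
  rw [nnrealExpMeasure, integrable_map_measure hf.aestronglyMeasurable
    measurable_real_toNNReal.aemeasurable,
    integrable_withDensity_iff_integrable_smul (measurable_exp_density θ)]
  refine integrable_congr (ae_of_all _ fun w => ?_)
  simp only [NNReal.smul_def, smul_eq_mul, Function.comp_apply]
  rw [Real.coe_toNNReal _ (by positivity)]

lemma isProbabilityMeasure_nnrealExpMeasure (hθ : 0 < θ) :
    IsProbabilityMeasure (nnrealExpMeasure θ) := by
  have hi := (integrableOn_exp_mul_Ioi (a := -θ) (by linarith) 0).const_mul θ
  have hI := integral_exp_mul_Ioi (a := -θ) (by linarith) 0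
  refine ⟨?_⟩
  rw [nnrealExpMeasure, Measure.map_apply measurable_real_toNNReal MeasurableSet.univ,
    Set.preimage_univ, withDensity_apply _ MeasurableSet.univ, Measure.restrict_univ]
  change ∫⁻ w in Set.Ioi (0 : ℝ), ENNReal.ofReal (θ * Real.exp (-(θ * w))) = 1
  rw [← ofReal_integral_eq_lintegral_ofReal (by simpa [neg_mul] using hi)
    (ae_of_all _ fun w => by positivity), integral_const_mul]
  simp only [neg_mul, mul_zero, Real.exp_zero] at hI
  rw [hI, neg_div_neg_eq, mul_one_div, div_self hθ.ne', ENNReal.ofReal_one]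

lemma integrableOn_rpow_mul_exp (hθ : 0 < θ) {p : ℝ} (hp : -1 < p) :
    IntegrableOn (fun w : ℝ => w ^ p * Real.exp (-(θ * w))) (Set.Ioi 0) := by
  have := integrableOn_rpow_mul_exp_neg_mul_rpow (p := 1) hp one_pos hθ
  simpa [neg_mul] using this

lemma integrable_pow_nnrealExpMeasure (hθ : 0 < θ) :
    Integrable (fun w : ℝ≥0 => (1 + 2 * w : ℝ) ^ 4) (nnrealExpMeasure θ) := by
  rw [integrable_nnrealExpMeasure_iff hθ (by fun_prop)]
  have h0 := (integrableOn_rpow_mul_exp hθ (p := 0) (by norm_num)).const_mul (8 * θ)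
  have h4 := (integrableOn_rpow_mul_exp hθ (p := 4) (by norm_num)).const_mul (128 * θ)
  refine (h0.add h4).mono' (by fun_prop) ?_
  refine (ae_restrict_iff' measurableSet_Ioi).2 (ae_of_all _ fun w hw => ?_)
  have hw0 : 0 < w := hw
  rw [Real.norm_of_nonneg (by positivity), Real.coe_toNNReal w hw0.le]
  simp only [Pi.add_apply, Real.rpow_zero, one_mul]
  rw [show w ^ (4 : ℝ) = w ^ 4 by norm_cast]
  -- Convexity of the fourth power: (1 + x)⁴ ≤ 8(1 + x⁴) with x = 2w.
  have hb : (1 + 2 * w) ^ 4 ≤ 8 + 128 * w ^ 4 := by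
    nlinarith [sq_nonneg (1 - 2 * w), sq_nonneg (1 - 4 * w ^ 2),
      mul_nonneg hw0.le (sq_nonneg (1 - 2 * w))]
  calc θ * Real.exp (-(θ * w)) * (1 + 2 * w) ^ 4
      ≤ θ * Real.exp (-(θ * w)) * (8 + 128 * w ^ 4) := by gcongr
    _ = _ := by ring

lemma integral_rpow_nnrealExpMeasure (hθ : 0 < θ) {p : ℝ} (hp : 0 < p) :
    ∫ w : ℝ≥0, (w : ℝ) ^ p ∂(nnrealExpMeasure θ) = Real.Gamma (p + 1) / θ ^ p := by
  rw [integral_nnrealExpMeasure hθ (by fun_prop)]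
  have h := Real.integral_rpow_mul_exp_neg_mul_Ioi (a := p + 1) (r := θ) (by linarith) hθ
  rw [add_sub_cancel_right] at h
  calc ∫ w in Set.Ioi (0 : ℝ), θ * Real.exp (-(θ * w)) * (w.toNNReal : ℝ) ^ p
      = ∫ w in Set.Ioi (0 : ℝ), θ * (w ^ p * Real.exp (-(θ * w))) := by
        refine setIntegral_congr_fun measurableSet_Ioi fun w hw => ?_
        simp only [Real.coe_toNNReal w (le_of_lt hw)]
        ring
    _ = _ := by
        rw [integral_const_mul, h, Real.div_rpow zero_le_one hθ.le, Real.one_rpow,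
          Real.rpow_add hθ, Real.rpow_one]
        field_simp

/-- Memorylessness: an exponential variable exceeds a with probability exp(-θa), and the excess is
then again exponential. -/
lemma integral_tsub_rpow_nnrealExpMeasure (hθ : 0 < θ) {p : ℝ} (hp : 0 < p) (a : ℝ≥0) :
    ∫ w : ℝ≥0, ((w - a : ℝ≥0) : ℝ) ^ p ∂(nnrealExpMeasure θ) =
      Real.exp (-(θ * a)) * (Real.Gamma (p + 1) / θ ^ p) := by
  rw [← integral_rpow_nnrealExpMeasure hθ hp, integral_nnrealExpMeasure hθ (by fun_prop),
    integral_nnrealExpMeasure hθ (by fun_prop), ← integral_const_mul]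
  have hpre := (measurePreserving_add_right volume (a : ℝ)).setIntegral_preimage_emb
    (measurableEmbedding_addRight (a : ℝ))
    (fun w : ℝ => θ * Real.exp (-(θ * w)) * ((w.toNNReal - a : ℝ≥0) : ℝ) ^ p) (Set.Ioi (a : ℝ))
  rw [Set.preimage_add_const_Ioi, sub_self] at hpre
  rw [setIntegral_eq_of_subset_of_forall_sdiff_eq_zero measurableSet_Ioi
    (Set.Ioi_subset_Ioi a.coe_nonneg) fun w hw => ?_, ← hpre]
  · refine setIntegral_congr_fun measurableSet_Ioi fun w hw => ?_
    have hw0 : 0 ≤ w := le_of_lt hw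
    have : (w + a).toNNReal - a = w.toNNReal := by
      rw [Real.toNNReal_add hw0 a.coe_nonneg, Real.toNNReal_coe, add_tsub_cancel_right]
    simp only [this]
    rw [mul_add, neg_add, Real.exp_add]
    ring
  · have : w.toNNReal - a = 0 := tsub_eq_zero_of_le
      (Real.toNNReal_le_iff_le_coe.2 (not_lt.1 hw.2))
    simp [this, Real.zero_rpow hp.ne']

lemma integral_exp_neg_mul_nnrealExpMeasure (hθ : 0 < θ) :
    ∫ w : ℝ≥0, Real.exp (-(θ * w)) ∂(nnrealExpMeasure θ) = 1 / 2 := by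
  rw [integral_nnrealExpMeasure hθ (by fun_prop)]
  have hI := integral_exp_mul_Ioi (a := -(2 * θ)) (by linarith) 0
  calc ∫ w in Set.Ioi (0 : ℝ), θ * Real.exp (-(θ * w)) * Real.exp (-(θ * w.toNNReal))
      = ∫ w in Set.Ioi (0 : ℝ), θ * Real.exp (-(2 * θ) * w) := by
        refine setIntegral_congr_fun measurableSet_Ioi fun w hw => ?_
        simp only [Real.coe_toNNReal w (le_of_lt hw)]
        rw [mul_assoc, ← Real.exp_add]
        ring_nf
    _ = 1 / 2 := by
        rw [integral_const_mul, hI]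
        simp only [mul_zero, Real.exp_zero]
        field_simp

lemma integrable_prod_rpow_nnrealExpMeasure (hθ : 0 < θ) {p : ℝ} (hp0 : 0 < p) (hp2 : p < 2)
    {f : ℝ≥0 × ℝ≥0 → ℝ} (hf : Measurable f) (h0 : ∀ q, 0 ≤ f q)
    (hle : ∀ q, f q ≤ (1 + 2 * q.1) * (1 + 2 * q.2)) :
    Integrable (fun q => f q ^ p) ((nnrealExpMeasure θ).prod (nnrealExpMeasure θ)) := by
  have := isProbabilityMeasure_nnrealExpMeasure hθ
  refine (integrable_prod_pow (integrable_pow_nnrealExpMeasure hθ)).mono'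
    (hf.pow_const p).aestronglyMeasurable (ae_of_all _ fun q => ?_)
  rw [Real.norm_of_nonneg (Real.rpow_nonneg (h0 q) p)]
  set M : ℝ := (1 + 2 * q.1) * (1 + 2 * q.2) with hM
  have hM1 : 1 ≤ M := one_le_mul_of_one_le_of_one_le (by simp) (by simp)
  calc f q ^ p ≤ M ^ p := Real.rpow_le_rpow (h0 q) (hle q) hp0.le
    _ ≤ M ^ (4 : ℝ) := Real.rpow_le_rpow_of_exponent_le hM1 (by linarith)
    _ = M ^ 4 := by norm_cast
    _ ≤ 32 * M ^ 4 := by linarith [pow_nonneg (zero_le_one.trans hM1) 4]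
    _ = _ := by rw [hM, mul_pow]

/-- Let M be the 2H-th moment of ν. Splitting |x - y| into positive parts, each part contributes M /
2 by memorylessness. The integral is (M + M - M) / 2, and Γ(2H+1) = 2H Γ(2H) finishes. -/
lemma integral_prod_nnrealExpMeasure (hθ : 0 < θ) {H : ℝ} (hH0 : 0 < H) (hH1 : H < 1) :
    ∫ q : ℝ≥0 × ℝ≥0, 1 / 2 * ((q.1 : ℝ) ^ (2 * H) + (q.2 : ℝ) ^ (2 * H) -
      |(q.1 : ℝ) - q.2| ^ (2 * H)) ∂((nnrealExpMeasure θ).prod (nnrealExpMeasure θ)) =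
      asympVariance H θ := by
  have := isProbabilityMeasure_nnrealExpMeasure hθ
  have hp0 : 0 < 2 * H := by linarith
  have hp2 : 2 * H < 2 := by linarith
  set ν := nnrealExpMeasure θ
  set M := Real.Gamma (2 * H + 1) / θ ^ (2 * H)
  have hb : ∀ x y : ℝ≥0, (x : ℝ) ≤ (1 + 2 * x) * (1 + 2 * y) ∧
      (y : ℝ) ≤ (1 + 2 * x) * (1 + 2 * y) := fun x y => by
    have := x.2; have := y.2
    have : (0 : ℝ) ≤ x * y := by positivity
    constructor <;> nlinarith [x.2, y.2]
  have htsub : ∀ x y : ℝ≥0, ((x - y : ℝ≥0) : ℝ) ≤ x := fun x y =>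
    NNReal.coe_le_coe.2 tsub_le_self
  have i1 : Integrable (fun q : ℝ≥0 × ℝ≥0 => (q.1 : ℝ) ^ (2 * H)) (ν.prod ν) :=
    integrable_prod_rpow_nnrealExpMeasure hθ hp0 hp2 (by fun_prop) (fun q => q.1.2)
      fun q => (hb q.1 q.2).1
  have i2 : Integrable (fun q : ℝ≥0 × ℝ≥0 => (q.2 : ℝ) ^ (2 * H)) (ν.prod ν) :=
    integrable_prod_rpow_nnrealExpMeasure hθ hp0 hp2 (by fun_prop) (fun q => q.2.2)
      fun q => (hb q.1 q.2).2
  have i3 : Integrable (fun q : ℝ≥0 × ℝ≥0 => ((q.1 - q.2 : ℝ≥0) : ℝ) ^ (2 * H)) (ν.prod ν) :=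
    integrable_prod_rpow_nnrealExpMeasure hθ hp0 hp2 (by fun_prop) (fun q => (q.1 - q.2).2)
      fun q => (htsub _ _).trans (hb q.1 q.2).1
  have i4 : Integrable (fun q : ℝ≥0 × ℝ≥0 => ((q.2 - q.1 : ℝ≥0) : ℝ) ^ (2 * H)) (ν.prod ν) :=
    integrable_prod_rpow_nnrealExpMeasure hθ hp0 hp2 (by fun_prop) (fun q => (q.2 - q.1).2)
      fun q => (htsub _ _).trans (hb q.1 q.2).2
  have e1 : ∫ q : ℝ≥0 × ℝ≥0, (q.1 : ℝ) ^ (2 * H) ∂(ν.prod ν) = M := by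
    rw [integral_fun_fst (fun x : ℝ≥0 => (x : ℝ) ^ (2 * H)),
      integral_rpow_nnrealExpMeasure hθ hp0]
    simp [M]
  have e2 : ∫ q : ℝ≥0 × ℝ≥0, (q.2 : ℝ) ^ (2 * H) ∂(ν.prod ν) = M := by
    rw [integral_fun_snd (fun x : ℝ≥0 => (x : ℝ) ^ (2 * H)),
      integral_rpow_nnrealExpMeasure hθ hp0]
    simp [M]
  have e4 : ∫ q : ℝ≥0 × ℝ≥0, ((q.2 - q.1 : ℝ≥0) : ℝ) ^ (2 * H) ∂(ν.prod ν) = M / 2 := by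
    rw [integral_prod _ i4]
    simp only [ν, integral_tsub_rpow_nnrealExpMeasure hθ hp0]
    rw [integral_mul_const, integral_exp_neg_mul_nnrealExpMeasure hθ]
    ring
  have e3 : ∫ q : ℝ≥0 × ℝ≥0, ((q.1 - q.2 : ℝ≥0) : ℝ) ^ (2 * H) ∂(ν.prod ν) = M / 2 := by
    rw [← e4]
    exact integral_prod_swap (μ := ν) (ν := ν)
      (fun q : ℝ≥0 × ℝ≥0 => ((q.2 - q.1 : ℝ≥0) : ℝ) ^ (2 * H))
  have habs : ∀ x y : ℝ≥0, |(x : ℝ) - y| ^ (2 * H) =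
      ((x - y : ℝ≥0) : ℝ) ^ (2 * H) + ((y - x : ℝ≥0) : ℝ) ^ (2 * H) := fun x y => by
    rcases le_total x y with h | h
    · rw [tsub_eq_zero_of_le h, NNReal.coe_sub h, NNReal.coe_zero, Real.zero_rpow hp0.ne',
        zero_add, abs_sub_comm, abs_of_nonneg (sub_nonneg.2 (NNReal.coe_le_coe.2 h))]
    · rw [tsub_eq_zero_of_le h, NNReal.coe_sub h, NNReal.coe_zero, Real.zero_rpow hp0.ne',
        add_zero, abs_of_nonneg (sub_nonneg.2 (NNReal.coe_le_coe.2 h))]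
  have i12 : Integrable (fun q : ℝ≥0 × ℝ≥0 => (q.1 : ℝ) ^ (2 * H) + (q.2 : ℝ) ^ (2 * H))
    (ν.prod ν) := i1.add i2
  have i34 : Integrable (fun q : ℝ≥0 × ℝ≥0 => ((q.1 - q.2 : ℝ≥0) : ℝ) ^ (2 * H) +
    ((q.2 - q.1 : ℝ≥0) : ℝ) ^ (2 * H)) (ν.prod ν) := i3.add i4
  simp only [habs]
  rw [integral_const_mul, integral_sub i12 i34, integral_add i1 i2, integral_add i3 i4, e1, e2,
    e3, e4, asympVariance]
  simp only [M, Real.Gamma_add_one hp0.ne']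
  ring

/-! ### Solving the Ornstein–Uhlenbeck equation pathwise. -/

/-- Variation of constants for the linear equation `x = -θ ∫ x + g`. -/
lemma eq_sub_integral_of_eq_neg_mul_integral {x g : ℝ → ℝ} (hx : Continuous x)
    (hg : Continuous g) (h : ∀ t, 0 ≤ t → x t = -θ * (∫ s in (0 : ℝ)..t, x s) + g t) {t : ℝ}
    (ht : 0 ≤ t) :
    x t = g t - ∫ w in (0 : ℝ)..t, θ * Real.exp (-(θ * w)) * g (t - w) := by
  set F : ℝ → ℝ := fun t => ∫ s in (0 : ℝ)..t, x s with hF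
  have hFd : ∀ t, HasDerivAt F (x t) t := fun t =>
    (hx.integral_hasStrictDerivAt 0 t).hasDerivAt
  have hE : ∀ t, HasDerivAt (fun t => Real.exp (θ * t)) (θ * Real.exp (θ * t)) t := fun t => by
    have := ((hasDerivAt_id t).const_mul θ).exp
    simpa [mul_comm] using this
  -- Integrating factor: F' = x = -θF + g on [0, t].
  have hder : ∀ u ∈ Set.uIcc 0 t, HasDerivAt (fun t => Real.exp (θ * t) * F t)
      (Real.exp (θ * u) * g u) u := fun u hu => by
    rw [Set.uIcc_of_le ht] at hu
    refine ((hE u).mul (hFd u)).congr_deriv ?_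
    rw [h u hu.1]
    ring
  have hint := intervalIntegral.integral_eq_sub_of_hasDerivAt hder
    (Continuous.intervalIntegrable (by fun_prop) _ _)
  have hF0 : F 0 = 0 := by simp [hF]
  rw [hF0, mul_zero, sub_zero] at hint
  have hsubst : ∫ w in (0 : ℝ)..t, θ * Real.exp (-(θ * w)) * g (t - w) =
      θ * Real.exp (-(θ * t)) * ∫ u in (0 : ℝ)..t, Real.exp (θ * u) * g u := by
    have := intervalIntegral.integral_comp_sub_left (a := 0) (b := t)
      (fun u => θ * Real.exp (-(θ * (t - u))) * g u) t
    simp only [sub_sub_cancel, sub_self, sub_zero] at this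
    rw [this, ← intervalIntegral.integral_const_mul]
    refine intervalIntegral.integral_congr fun u _ => ?_
    rw [show -(θ * (t - u)) = -(θ * t) + θ * u by ring, Real.exp_add]
    ring
  have hexp : Real.exp (-(θ * t)) * Real.exp (θ * t) = 1 := by rw [← Real.exp_add]; simp
  rw [hsubst, hint, h t ht]
  linear_combination θ * F t * hexp

/-- Total mass 1 puts s t - s 0 under the integral. For w > t the truncated time is 0, so s (t - w)
- s 0 vanishes and the half-line integral agrees with the one over (0, t]. -/
lemma eq_integral_nnrealExpMeasure {x s : ℝ≥0 → ℝ} (hθ : 0 < θ) (hx : Continuous x)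
    (hs : Continuous s)
    (h : ∀ t : ℝ≥0, x t = -θ * (∫ u in (0 : ℝ)..t, x u.toNNReal) + (s t - s 0)) (t : ℝ≥0) :
    x t = ∫ w, (s t - s (t - w)) ∂(nnrealExpMeasure θ) := by
  have := isProbabilityMeasure_nnrealExpMeasure hθ
  set g : ℝ → ℝ := fun r => s r.toNNReal - s 0 with hg
  have hgc : Continuous g := (hs.comp continuous_real_toNNReal).sub continuous_const
  have hsol := eq_sub_integral_of_eq_neg_mul_integral (θ := θ) (x := fun r => x r.toNNReal)
    (g := g) (hx.comp continuous_real_toNNReal) hgc (fun r hr => by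
      have := h r.toNNReal
      rwa [Real.coe_toNNReal r hr] at this) t.coe_nonneg
  have hc : Continuous fun w : ℝ≥0 => s (t - w) := hs.comp (by fun_prop)
  obtain ⟨C, hC⟩ := (isCompact_Icc (a := (0 : ℝ≥0)) (b := t)).exists_bound_of_continuousOn
    (f := fun u => s u - s 0) (hs.sub continuous_const).continuousOn
  have hi : Integrable (fun w => s (t - w) - s 0) (nnrealExpMeasure θ) :=
    (integrable_const C).mono' (hc.sub continuous_const).aestronglyMeasurable
      (ae_of_all _ fun w => hC _ ⟨zero_le, tsub_le_self⟩)
  have hsplit : ∀ w, s t - s (t - w) = (s t - s 0) - (s (t - w) - s 0) := fun w => by ring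
  have hm : Measurable fun w => s (t - w) - s 0 := (hc.sub continuous_const).measurable
  simp only [hsplit]
  rw [integral_sub (integrable_const _) hi, integral_const, probReal_univ, one_smul,
    integral_nnrealExpMeasure hθ hm]
  simp only [Real.toNNReal_coe, hg] at hsol
  rw [hsol]
  congr 1
  rw [intervalIntegral.integral_of_le t.coe_nonneg,
    setIntegral_eq_of_subset_of_forall_sdiff_eq_zero measurableSet_Ioi
      (show Set.Ioc (0 : ℝ) t ⊆ Set.Ioi 0 from fun w hw => hw.1) fun w hw => ?_]
  · refine setIntegral_congr_fun measurableSet_Ioc fun w hw => ?_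
    have : (t - w : ℝ).toNNReal = t - w.toNNReal := by
      refine NNReal.eq ?_
      rw [Real.coe_toNNReal _ (sub_nonneg.2 hw.2),
        NNReal.coe_sub (Real.toNNReal_le_iff_le_coe.2 hw.2), Real.coe_toNNReal w hw.1.le]
    simp only [this]
  · have hw' : (t : ℝ) < w := by
      by_contra hcon
      exact hw.2 ⟨hw.1, not_lt.1 hcon⟩
    have : t - w.toNNReal = 0 := tsub_eq_zero_of_le (by
      rw [← Real.toNNReal_coe (r := t)]
      exact Real.toNNReal_le_toNNReal hw'.le)
    simp [this]

end

theorem mainTheorem6 {Ω : Type*} [MeasurableSpace Ω] (P : Measure Ω) [IsProbabilityMeasure P]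
    (H θ : ℝ) (hH0 : 0 < H) (hH1 : H < 1) (hθ : 0 < θ)
    (S X : ℝ≥0 → Ω → ℝ) (hS : IsSubFractionalBM P H S) (hX : IsOUSolution P θ S X) :
    ∀ᵐ ω ∂P, Tendsto (fun n : ℕ => quadEstimator X n ω) atTop (𝓝 (asympVariance H θ)) := by
  have := isProbabilityMeasure_nnrealExpMeasure hθ
  have hrep : ∀ᵐ ω ∂P, ∀ t, X t ω = ∫ w, (S t ω - S (t - w) ω) ∂(nnrealExpMeasure θ) := by
    filter_upwards [hX, hS.continuous_paths] with ω hω hc t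
    exact eq_integral_nnrealExpMeasure hθ hω.1 hc hω.2.2 t
  have hlim := hS.ae_tendsto_average_sq hH0 hH1 (integrable_pow_nnrealExpMeasure hθ) hrep
  rw [integral_prod_nnrealExpMeasure hθ hH0 hH1] at hlim
  filter_upwards [hlim] with ω hω
  refine hω.congr fun n => ?_
  rw [quadEstimator, one_div, inv_mul_eq_div]
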